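/- Let $\mathbb T=\mathbb R/\mathbb Z$ with Lebesgue measure $\lambda$, let $\alpha$ be an irrational number whose continued fraction partial quotients $a_1,a_2,\dots$ are bounded, and let $Tx=x+\alpha$ on $\mathbb T$. Let $C_1,C_2>0$ be constants such that, for every integer $k\ge 1$, each of the arcs $J$ into which the points $0,-\alpha,\dots,-(k-1)\alpha$ divide $\mathbb T$ satisfies $\frac{C_2}{k}\le |J|<\frac{C_1}{k}$. Let $\mathcal U$ be the set of left-continuous functions $f:\mathbb T\to\mathbb R$ of bounded variation such that, viewing $f$ as a function on $[0,1]$ with $f(1)=f(1^-)$, the function $f_a(x)=f(x)-\sum_{0\le y<x}(f(y^+)-f(y^-))$ is absolutely continuous on $[0,1]$ (one-sided limits are taken on $\mathbb T$; that is, $f$ has no singular continuous part), and $S(f):=f_a(1)-f_a(0)=\int_{\mathbb T} f'\,d\lambda\neq 0$. Let $f\in\mathcal U$ satisfy $f\ge c$ on $\mathbb T$ for some constant $c>0$. Let $(\beta_i)_{i\ge1}$ be a sequence of distinct points of $\mathbb T$ containing all discontinuity points of $f$, and let $d_i=f(\beta_i^+)-f(\beta_i^-)$ be the jump of $f$ at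 $\beta_i$ (zero if $f$ is continuous at $\beta_i$). Suppose that there is a function $\eta:(0,\infty)\to[0,\infty)$ with $\liminf_{\varepsilon\to0^+}\eta(\varepsilon)\,\varepsilon=0$ and $$\sum_{i>\eta(\varepsilon)}|d_i|<\frac{\varepsilon}{\frac{C_2}{C_1}+1}\qquad\text{for every }\varepsilon>0 .$$ Let $(T^f_t)_{t\in\mathbb R}$ be the special flow over $T$ under the roof function $f$, i.e. on $X^f=\{(x,s)\in\mathbb T\times\mathbb R: 0\le s<f(x)\}$ with the restriction $\mu^f$ of $\lambda\times$Lebesgue measure, $T^f_t(x,s)=(T^nx,\,s+t-f^{(n)}(x))$, where $f^{(n)}$ $(n\in\mathbb Z)$ is the cocycle generated by $f$ over $T$ (so $f^{(0)}=0$ and $f^{(n+1)}=f^{(n)}+f\circ T^n$) and $n\in\mathbb Z$ is the unique integer with $f^{(n)}(x)\le s+t<f^{(n+1)}(x)$. Then $(T^f_t)_{t\in\mathbb R}$ is not partially rigid: there are no sequence $t_n\to+\infty$ and no $u\in(0,1]$ such that $\liminf_{n\to\infty}\mu^f(B\cap T^f_{-t_n}B)\ge u\,\mu^f(B)$ for every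 measurable $B\subset X^f$. -/

import Mathlib

open MeasureTheory Filter Set
open scoped Topology

noncomputable section

/-! ### Special flows and partial rigidity -/

/-- The cocycle over an invertible map `T`:
`f⁽ⁿ⁾(x) = f(x) + ⋯ + f(Tⁿ⁻¹x)` for `n > 0`, `f⁽⁰⁾ = 0`, and
`f⁽ⁿ⁾(x) = -(f(Tⁿx) + ⋯ + f(T⁻¹x))` for `n < 0`. -/
def cocycleSum {X : Type*} (T : Equiv.Perm X) (f : X → ℝ) (n : ℤ) (x : X) : ℝ :=
  ∑ k ∈ Finset.Ico (0 : ℤ) n, f ((T ^ k) x) - ∑ k ∈ Finset.Ico n (0 : ℤ), f ((T ^ k) x)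

theorem cocycleSum_zero {X : Type*} (T : Equiv.Perm X) (f : X → ℝ) (x : X) :
    cocycleSum T f 0 x = 0 := by
  simp [cocycleSum]

theorem cocycleSum_add_one {X : Type*} (T : Equiv.Perm X) (f : X → ℝ) (n : ℤ) (x : X) :
    cocycleSum T f (n + 1) x = cocycleSum T f n x + f ((T ^ n) x) := by
  unfold cocycleSum
  rcases le_or_gt 0 n with h | h
  · have h1 : Finset.Ico (0 : ℤ) (n + 1) = insert n (Finset.Ico (0 : ℤ) n) := by
      ext k; simp only [Finset.mem_Ico, Finset.mem_insert]; omega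
    have h2 : Finset.Ico (n + 1) (0 : ℤ) = ∅ := Finset.Ico_eq_empty (by omega)
    have h3 : Finset.Ico n (0 : ℤ) = ∅ := Finset.Ico_eq_empty (by omega)
    rw [h1, h2, h3, Finset.sum_insert (by simp)]
    ring
  · have h1 : Finset.Ico n (0 : ℤ) = insert n (Finset.Ico (n + 1) (0 : ℤ)) := by
      ext k; simp only [Finset.mem_Ico, Finset.mem_insert]; omega
    have h2 : Finset.Ico (0 : ℤ) (n + 1) = ∅ := Finset.Ico_eq_empty (by omega)
    have h3 : Finset.Ico (0 : ℤ) n = ∅ := Finset.Ico_eq_empty (by omega)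
    rw [h1, h2, h3, Finset.sum_insert (by simp)]
    ring

theorem existsUnique_cocycleSum_index {X : Type*} (T : Equiv.Perm X) (f : X → ℝ)
    (hf : ∃ c > 0, ∀ x, c ≤ f x) (x : X) (r : ℝ) :
    ∃! n : ℤ, cocycleSum T f n x ≤ r ∧ r < cocycleSum T f (n + 1) x := by
  obtain ⟨c, hc, hcf⟩ := hf
  have hmono : StrictMono (fun n : ℤ => cocycleSum T f n x) := by
    refine strictMono_int_of_lt_succ fun n => ?_
    have := hcf ((T ^ n) x)
    simp only [cocycleSum_add_one]
    linarith
  have hdiff : Monotone (fun n : ℤ => cocycleSum T f n x - c * n) := by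
    refine monotone_int_of_le_succ fun n => ?_
    have := hcf ((T ^ n) x)
    simp only [cocycleSum_add_one]
    push_cast
    linarith
  have hlow : ∃ n : ℤ, cocycleSum T f n x ≤ r := by
    refine ⟨min 0 ⌊r / c⌋, ?_⟩
    have h1 := hdiff (min_le_left 0 ⌊r / c⌋)
    have h2 : ((min 0 ⌊r / c⌋ : ℤ) : ℝ) ≤ r / c :=
      le_trans (Int.cast_le.mpr (min_le_right _ _)) (Int.floor_le _)
    have h3 : c * ((min 0 ⌊r / c⌋ : ℤ) : ℝ) ≤ r := by
      rw [le_div_iff₀ hc] at h2; linarith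
    simp only [cocycleSum_zero] at h1
    push_cast at h1 h3
    linarith
  have hbdd : ∃ b : ℤ, ∀ n : ℤ, cocycleSum T f n x ≤ r → n ≤ b := by
    refine ⟨max 0 ⌈r / c⌉, fun n hn => ?_⟩
    by_contra! hlt
    have h0 : (0 : ℤ) ≤ n := le_trans (le_max_left _ _) hlt.le
    have h1 := hdiff h0
    have h2 : r / c < (n : ℝ) :=
      lt_of_le_of_lt (Int.le_ceil _) (Int.cast_lt.mpr (lt_of_le_of_lt (le_max_right _ _) hlt))
    rw [div_lt_iff₀ hc] at h2
    simp only [cocycleSum_zero] at h1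
    push_cast at h1
    linarith
  obtain ⟨n, hn, hmax⟩ := Int.exists_greatest_of_bdd hbdd hlow
  refine ⟨n, ⟨hn, ?_⟩, ?_⟩
  · by_contra! h
    have := hmax _ h
    omega
  · rintro m ⟨hm1, hm2⟩
    have h1 : m ≤ n := hmax m hm1
    have h2 : n < m + 1 := hmono.lt_iff_lt.mp (lt_of_le_of_lt hn hm2)
    omega

/-- The phase space `X^f = {(x, s) : 0 ≤ s < f x}` of the special flow under `f`. -/
def specialSpace {X : Type*} (f : X → ℝ) : Set (X × ℝ) :=
  {p | 0 ≤ p.2 ∧ p.2 < f p.1}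

/-- The measure `μ^f`: the restriction of `μ × Lebesgue` to `X^f`. -/
def specialMeasure {X : Type*} [MeasurableSpace X] (μ : Measure X) (f : X → ℝ) :
    Measure (specialSpace f) :=
  (μ.prod volume).comap Subtype.val

/-- The special flow `T_t^f (x, s) = (Tⁿ x, s + t - f⁽ⁿ⁾(x))`, where `n` is the unique integer with
`f⁽ⁿ⁾(x) ≤ s + t < f⁽ⁿ⁺¹⁾(x)`; the roof function is bounded away from zero. -/
def specialFlow {X : Type*} (T : Equiv.Perm X) (f : X → ℝ) (hf : ∃ c > 0, ∀ x, c ≤ f x)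
    (t : ℝ) (p : specialSpace f) : specialSpace f :=
  let h := (existsUnique_cocycleSum_index T f hf p.1.1 (p.1.2 + t)).exists
  ⟨((T ^ h.choose) p.1.1, p.1.2 + t - cocycleSum T f h.choose p.1.1), by
    have h1 := h.choose_spec
    rw [cocycleSum_add_one] at h1
    exact ⟨by linarith [h1.1], by linarith [h1.2]⟩⟩

/-- A flow is partially rigid if there are `tₙ → +∞` and `0 < u ≤ 1` with
`liminf μ(B ∩ S_{-tₙ} B) ≥ u μ(B)` for every measurable `B`; here
`S_{-t} B` is written as the preimage of `B` under `S_t`. -/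
def IsPartiallyRigid {X : Type*} [MeasurableSpace X] (S : ℝ → X → X) (μ : Measure X) : Prop :=
  ∃ t : ℕ → ℝ, Tendsto t atTop atTop ∧ ∃ u : ℝ, 0 < u ∧ u ≤ 1 ∧
    ∀ B : Set X, MeasurableSet B →
      ENNReal.ofReal u * μ B ≤ liminf (fun n => μ (B ∩ S (t n) ⁻¹' B)) atTop

/-! ### Rotations -/

/-- The rotation `x ↦ x + α` of the circle `ℝ / ℤ`. -/
def circleRotation (α : ℝ) : Equiv.Perm UnitAddCircle :=
  Equiv.addRight (α : UnitAddCircle)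

/-- The partial quotients `a₁, a₂, …` of the continued fraction of `α` are bounded. -/
def HasBoundedPartialQuotients (α : ℝ) : Prop :=
  ∃ C : ℝ, ∀ (n : ℕ) (a : ℝ), (GenContFract.of α).partDens.get? n = some a → a ≤ C

/-- `ℓ` is the length of one of the arcs into which the points `0, -α, …, -(k-1)α` divide the
circle: the open arc that starts at `-iα` and ends at `-jα`, after length `ℓ`, contains none of
these points. -/
def IsPartitionArcLength (α : ℝ) (k : ℕ) (ℓ : ℝ) : Prop :=
  0 < ℓ ∧ ∃ i < k, ∃ j < k,
    ((-(i * α) + ℓ : ℝ) : UnitAddCircle) = ((-(j * α) : ℝ) : UnitAddCircle) ∧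
    ∀ t ∈ Ioo 0 ℓ, ∀ m < k,
      ((-(i * α) + t : ℝ) : UnitAddCircle) ≠ ((-(m * α) : ℝ) : UnitAddCircle)

/-! ### Functions of bounded variation on the circle -/

/-- A function on the circle as a `1`-periodic function on the line. -/
def circleLift (f : UnitAddCircle → ℝ) (x : ℝ) : ℝ := f (x : UnitAddCircle)

/-- The jump `f(y⁺) - f(y⁻)`. -/
def circleJump (f : UnitAddCircle → ℝ) (y : ℝ) : ℝ :=
  Function.rightLim (circleLift f) y - Function.leftLim (circleLift f) y

/-- The jump part `x ↦ ∑_{0 ≤ y < x} (f(y⁺) - f(y⁻))` on `[0, 1]`. -/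
def jumpPart (f : UnitAddCircle → ℝ) (x : ℝ) : ℝ :=
  ∑' y : Ico (0 : ℝ) x, circleJump f y

/-- What remains of `f` on `[0, 1]` when the jump part is removed; the value of `f` at `1` is
`f(1⁻) = f(0)` for left-continuous `f`. -/
def continuousPart (f : UnitAddCircle → ℝ) (x : ℝ) : ℝ :=
  circleLift f x - jumpPart f x

/-- `S(f) = f_a(1) - f_a(0)` for the absolutely continuous part `f_a` of a function `f` without
singular continuous part. -/
def slopeS (f : UnitAddCircle → ℝ) : ℝ :=
  continuousPart f 1 - continuousPart f 0

/-- Left-continuous functions of bounded variation on the circle whose singular continuous part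
vanishes. -/
def classV : Set (UnitAddCircle → ℝ) :=
  {f | (∀ x : ℝ, ContinuousWithinAt (circleLift f) (Iic x) x) ∧
    BoundedVariationOn (circleLift f) (Icc 0 1) ∧
    AbsolutelyContinuousOnInterval (continuousPart f) 0 1}

/-- The functions in `classV` with `S(f) ≠ 0`. -/
def classU : Set (UnitAddCircle → ℝ) :=
  {f | f ∈ classV ∧ slopeS f ≠ 0}

end

/-! Test partial rigidity on the thin strip `B = {s < ε}`, which has measure `ε`. If a point of `B`
over `x` is in `B` again at time `t`, some Birkhoff sum `f⁽ⁿ⁾(x)` lies within `ε` of `t`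
(`specialMeasure_bottom_inter_preimage_le`). Hence it suffices that, for suitable `ε` and all large
`t`, the set of such `x` has measure at most `u / 2`; `exists_volume_abs_rotationSum_sub_lt_le`
bounds it by a constant times `(η(ε) + 2) ε`, and the liminf condition on `η` makes this small.

For that bound, only `n ≤ J` with `J` of order `t` matter. Cut the circle into at most `(η(ε) + 2)
J` cells of length at most `1 / J` whose first `J` translates avoid `0` and the `η(ε)` leading
discontinuities in their interior. On a cell, `f⁽ⁿ⁾` is linear with slope `n S(f)` up to `O(ε)`
(`abs_rotationSum_sub_le`). The derivative part averages out by unique ergodicity, up to an `L¹`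
error, and the remaining jumps have total size at most `ε`. Both errors are multiplied only by the
number of translates of a cell that cover one point. That number is bounded because the orbit points
are `C₂ / J`-separated.

Since `S(f) ≠ 0` and `n` is comparable to `J`, each `n` contributes a set of length `O(ε / J)` in a
cell. As `f ≥ c`, only boundedly many `n` contribute (`volume_exists_abs_sub_lt_le`). Summing over
the cells cancels `J`. -/

/-! ### Separation of the orbit points of the rotation. -/

theorem Int.fract_eq_of_coe_eq {s b : ℝ} (h0 : 0 ≤ s) (h1 : s < 1)
    (h : (s : UnitAddCircle) = (b : UnitAddCircle)) : Int.fract b = s := by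
  have h' : ((s - b : ℝ) : UnitAddCircle) = 0 := by rw [AddCircle.coe_sub, h, sub_self]
  rw [AddCircle.coe_eq_zero_iff] at h'
  obtain ⟨n, hn⟩ := h'
  rw [Int.fract_eq_iff]
  refine ⟨h0, h1, -n, ?_⟩
  simp at hn
  push_cast
  linarith

theorem Irrational.fract_natCast_mul_sub_pos {α : ℝ} (hα : Irrational α) {i j : ℕ} (hij : i ≠ j) :
    0 < Int.fract ((i : ℝ) * α - j * α) := by
  refine lt_of_le_of_ne (Int.fract_nonneg _) fun h => ?_
  have h2 : Irrational (((i : ℤ) - (j : ℤ) : ℤ) * α) :=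
    hα.intCast_mul (sub_ne_zero.mpr (by exact_mod_cast hij))
  have h3 : ((((i : ℤ) - (j : ℤ) : ℤ) : ℝ) * α) = (⌊(i : ℝ) * α - j * α⌋ : ℤ) := by
    have := Int.self_sub_fract ((i : ℝ) * α - j * α)
    push_cast
    rw [← h] at this
    linarith
  rw [h3] at h2
  exact h2.ne_int _ rfl

/-- A lower bound for the arcs of the partition by `0, -α, …, -(k-1)α` bounds the distance of any
two of these points. -/
theorem le_fract_of_le_partitionArcLength {α : ℝ} (hα : Irrational α) {k : ℕ} {δ : ℝ}
    (h : ∀ ℓ, IsPartitionArcLength α k ℓ → δ ≤ ℓ) {i j : ℕ} (hi : i < k) (hj : j < k)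
    (hij : i ≠ j) : δ ≤ Int.fract ((i : ℝ) * α - j * α) := by
  -- A pair with the least directed distance bounds an arc of the partition: a further point inside
  -- it would be closer to `-aα`.
  obtain ⟨⟨a, b⟩, hab, hmin⟩ := Finset.exists_min_image (Finset.range k).offDiag
    (fun q : ℕ × ℕ => Int.fract ((q.1 : ℝ) * α - q.2 * α))
    ⟨(i, j), by simp [Finset.mem_offDiag, hi, hj, hij]⟩
  simp only [Finset.mem_offDiag, Finset.mem_range] at hab
  refine (h _ ⟨hα.fract_natCast_mul_sub_pos hab.2.2, a, hab.1, b, hab.2.1, ?_, ?_⟩).trans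
    (hmin (i, j) (by simp [Finset.mem_offDiag, hi, hj, hij]))
  · have : (-(a * α) + Int.fract ((a : ℝ) * α - b * α) : ℝ)
        = -(b * α) - (⌊(a : ℝ) * α - b * α⌋ : ℤ) := by
      rw [Int.fract]; ring
    rw [this, AddCircle.coe_sub]
    simp
  · intro s hs m hm hsm
    have h1 : (s : UnitAddCircle) = ((a * α - m * α : ℝ) : UnitAddCircle) := by
      have : (s : ℝ) = a * α + (-(a * α) + s) := by ring
      rw [this, AddCircle.coe_add, hsm, ← AddCircle.coe_add]
      congr 1
    have h2 := Int.fract_eq_of_coe_eq hs.1.le (hs.2.trans (Int.fract_lt_one _)) h1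
    have ham : a ≠ m := by
      rintro rfl
      rw [sub_self, Int.fract_zero] at h2
      exact hs.1.ne h2
    have h3 := hmin (a, m) (by simp [Finset.mem_offDiag, hab.1, hm, ham])
    simp only [h2] at h3
    exact absurd hs.2 (not_lt.mpr h3)

/-- An arc of length `ℓ` contains at most `ℓ / δ + 1` of `k` points of mutual distance `δ`. -/
theorem card_filter_fract_le {α δ : ℝ} {k : ℕ} (hδ : 0 < δ)
    (h : ∀ i < k, ∀ j < k, i ≠ j → δ ≤ Int.fract ((i : ℝ) * α - j * α)) (b ℓ : ℝ) :
    ((Finset.range k).filter fun i : ℕ => Int.fract (b - i * α) ≤ ℓ).card ≤ ⌊ℓ / δ⌋₊ + 1 := by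
  rw [← Finset.card_range (⌊ℓ / δ⌋₊ + 1)]
  -- Sort the points into bins of length `δ`; two points in one bin would be less than `δ` apart.
  refine Finset.card_le_card_of_injOn (fun i : ℕ => ⌊Int.fract (b - i * α) / δ⌋₊) ?_ ?_
  · intro i hi
    simp only [Finset.coe_filter, Finset.mem_range, mem_ofPred_eq] at hi
    simp only [Finset.coe_range, mem_Iio, Nat.lt_succ_iff]
    exact Nat.floor_le_floor (div_le_div_of_nonneg_right hi.2 hδ.le)
  · have key : ∀ i < k, ∀ j < k, i ≠ j →
        ⌊Int.fract (b - i * α) / δ⌋₊ = ⌊Int.fract (b - j * α) / δ⌋₊ →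
        Int.fract (b - i * α) ≤ Int.fract (b - j * α) → False := by
      intro i hi j hj hij hfl hle
      have h1 := Nat.lt_floor_add_one (Int.fract (b - j * α) / δ)
      have h2 := Nat.floor_le (div_nonneg (Int.fract_nonneg (b - i * α)) hδ.le)
      rw [← hfl] at h1
      have h3 : Int.fract (b - j * α) - Int.fract (b - i * α) < δ := by
        rw [le_div_iff₀ hδ] at h2
        rw [div_lt_iff₀ hδ] at h1
        linarith
      have h4 : Int.fract ((i : ℝ) * α - j * α)
          = Int.fract (b - j * α) - Int.fract (b - i * α) := by
        rw [Int.fract_eq_iff]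
        have h5 := Int.fract_lt_one (b - j * α)
        have h6 := Int.fract_nonneg (b - i * α)
        refine ⟨by linarith, by linarith, ⌊b - j * α⌋ - ⌊b - i * α⌋, ?_⟩
        simp only [Int.fract]
        push_cast
        ring
      linarith [h i hi j hj hij]
    intro i hi j hj hij
    simp only [Finset.coe_filter, Finset.mem_range, mem_ofPred_eq] at hi hj
    by_contra hne
    rcases le_total (Int.fract (b - i * α)) (Int.fract (b - j * α)) with hle | hle
    · exact key i hi.1 j hj.1 hne hij hle
    · exact key j hj.1 i hi.1 (Ne.symm hne) hij.symm hle

/-! ### Birkhoff sums of trigonometric polynomials and `L¹` approximation. -/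

/-- Birkhoff sums of trigonometric polynomials over an irrational rotation stay at bounded distance
from their linear drift. -/
theorem exists_norm_sum_sub_le_of_mem_span_fourier {α : ℝ} (hα : Irrational α)
    {q : C(UnitAddCircle, ℂ)} (hq : q ∈ Submodule.span ℂ (range (@fourier 1))) :
    ∃ K : ℝ, ∀ (n : ℕ) (x : UnitAddCircle),
      ‖∑ k ∈ Finset.range n, q (x + ((k * α : ℝ) : UnitAddCircle)) - n * ∫ z, q z‖ ≤ K := by
  induction hq using Submodule.span_induction with
  | mem q hq =>
    obtain ⟨m, rfl⟩ := hq
    have hsum : ∀ (n : ℕ) (x : UnitAddCircle),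
        ∑ k ∈ Finset.range n, fourier m (x + ((k * α : ℝ) : UnitAddCircle))
          = fourier m x * ∑ k ∈ Finset.range n, (fourier m (α : UnitAddCircle)) ^ k := by
      intro n x
      rw [Finset.mul_sum]
      refine Finset.sum_congr rfl fun k _ => ?_
      have hk : ((k * α : ℝ) : UnitAddCircle) = k • (α : UnitAddCircle) := by
        rw [← AddCircle.coe_nsmul, nsmul_eq_mul]
      simp only [fourier_apply, smul_add, AddCircle.toCircle_add, Circle.coe_mul, hk]
      rw [smul_comm, AddCircle.toCircle_nsmul]
      simp
    have hone : ∀ x : UnitAddCircle, ‖fourier m x‖ = 1 := fun x => by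
      rw [fourier_apply]; exact Circle.norm_coe _
    have hint : ∫ z : UnitAddCircle, fourier m z = if m = 0 then 1 else 0 := by
      split_ifs with hm
      · subst hm; simp [measureReal_def]
      · have h1 := fourierCoeff_fourier (T := 1) m
        have h2 := congrFun h1 0
        simp only [fourierCoeff, neg_zero, fourier_zero, one_smul] at h2
        rw [AddCircle.integral_haarAddCircle] at h2
        simpa [Pi.single_apply, Ne.symm hm] using h2
    by_cases hm : m = 0
    · refine ⟨0, fun n x => ?_⟩
      rw [hint, if_pos hm]
      subst hm
      simp
    · rw [hint, if_neg hm]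
      set w : ℂ := fourier m (α : UnitAddCircle) with hw
      have hw1 : w ≠ 1 := by
        intro h
        rw [hw, fourier_coe_apply, Complex.exp_eq_one_iff] at h
        obtain ⟨l, hl⟩ := h
        have hpi : (2 * Real.pi * Complex.I : ℂ) ≠ 0 := Complex.two_pi_I_ne_zero
        have h3 : ((m : ℂ) * (α : ℂ)) = l := by
          apply mul_left_cancel₀ hpi
          rw [mul_comm _ (l : ℂ), ← hl]
          push_cast
          ring
        have h4 : (m : ℝ) * α = l := by exact_mod_cast h3
        exact (hα.intCast_mul hm).ne_int l h4
      -- Bound for the geometric sum `(wⁿ - 1) / (w - 1)` with `‖w‖ = 1`, uniform in `n` and `x`.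
      refine ⟨2 / ‖w - 1‖, fun n x => ?_⟩
      rw [hsum, mul_zero, sub_zero, norm_mul, hone, one_mul, geom_sum_eq hw1, norm_div]
      gcongr
      refine (norm_sub_le _ _).trans ?_
      rw [norm_pow, hw, hone]
      norm_num
  | zero => exact ⟨0, fun n x => by simp⟩
  | add p q _ _ hp hq =>
    obtain ⟨K, hK⟩ := hp
    obtain ⟨L, hL⟩ := hq
    refine ⟨K + L, fun n x => ?_⟩
    have hi : ∀ r : C(UnitAddCircle, ℂ), Integrable r volume := fun r =>
      r.continuous.integrable_of_hasCompactSupport (HasCompactSupport.of_compactSpace _)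
    simp only [ContinuousMap.add_apply, Finset.sum_add_distrib]
    rw [integral_add (hi p) (hi q)]
    refine le_trans (le_of_eq ?_) ((norm_add_le _ _).trans (add_le_add (hK n x) (hL n x)))
    congr 1
    ring
  | smul a q _ hq =>
    obtain ⟨K, hK⟩ := hq
    refine ⟨‖a‖ * K, fun n x => ?_⟩
    simp only [ContinuousMap.smul_apply, smul_eq_mul]
    rw [integral_const_mul, ← Finset.mul_sum, mul_left_comm, ← mul_sub, norm_mul]
    exact mul_le_mul_of_nonneg_left (hK n x) (norm_nonneg a)

/-- A mean-zero integrable function on the circle is `L¹`-close to a continuous function with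
slowly growing Birkhoff sums. -/
theorem exists_continuous_approx_sum_le {α : ℝ} (hα : Irrational α)
    {φ : UnitAddCircle → ℝ} (hφ : Integrable φ) (h0 : ∫ z, φ z = 0) {δ : ℝ} (hδ : 0 < δ) :
    ∃ p : C(UnitAddCircle, ℝ), ∫ z, |φ z - p z| ≤ δ ∧ ∃ K : ℝ, 0 ≤ K ∧
      ∀ (n : ℕ) (x : UnitAddCircle),
        |∑ k ∈ Finset.range n, p (x + ((k * α : ℝ) : UnitAddCircle))| ≤ δ * n + K := by
  have hi : ∀ r : C(UnitAddCircle, ℂ), Integrable r volume := fun r =>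
    r.continuous.integrable_of_hasCompactSupport (HasCompactSupport.of_compactSpace _)
  have hφc : Integrable (fun z => (φ z : ℂ)) := hφ.ofReal
  obtain ⟨g, hg, hgi⟩ := hφc.exists_boundedContinuous_integral_sub_le (half_pos hδ)
  have hmem : g.toContinuousMap ∈ closure
      (Submodule.span ℂ (range (@fourier 1)) : Set C(UnitAddCircle, ℂ)) := by
    rw [← Submodule.topologicalClosure_coe, span_fourier_closure_eq_top]
    trivial
  obtain ⟨q, hq, hgq⟩ := Metric.mem_closure_iff.mp hmem _ (half_pos hδ)
  have hclose : ∫ z, ‖(φ z : ℂ) - q z‖ ≤ δ := by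
    have hb : ∀ z, ‖(φ z : ℂ) - q z‖ ≤ ‖(φ z : ℂ) - g z‖ + δ / 2 := by
      intro z
      have h1 : ‖g z - q z‖ ≤ δ / 2 := by
        have := ContinuousMap.dist_apply_le_dist (f := g.toContinuousMap) (g := q) z
        rw [dist_eq_norm] at this
        exact this.trans hgq.le
      calc ‖(φ z : ℂ) - q z‖ = ‖((φ z : ℂ) - g z) + (g z - q z)‖ := by ring_nf
        _ ≤ _ := (norm_add_le _ _).trans (by linarith)
    calc ∫ z, ‖(φ z : ℂ) - q z‖ ≤ ∫ z : UnitAddCircle, (‖(φ z : ℂ) - g z‖ + δ / 2) :=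
          integral_mono (hφc.sub (hi q)).norm
            ((hφc.sub hgi).norm.add (integrable_const _)) hb
      _ = (∫ z, ‖(φ z : ℂ) - g z‖) + δ / 2 := by
          rw [integral_add (f := fun z => ‖(φ z : ℂ) - g z‖) (hφc.sub hgi).norm
            (integrable_const _)]
          simp [measureReal_def]
      _ ≤ δ := by linarith
  obtain ⟨K, hK⟩ := exists_norm_sum_sub_le_of_mem_span_fourier hα hq
  refine ⟨⟨fun z => (q z).re, by fun_prop⟩, ?_, |K|, abs_nonneg _, fun n x => ?_⟩
  · refine le_trans (integral_mono ?_ (hφc.sub (hi q)).norm fun z => ?_) hclose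
    · exact (hφ.sub (hi q).re).abs
    · have := Complex.abs_re_le_norm ((φ z : ℂ) - q z)
      simpa using this
  -- As `φ` has mean zero, the mean of `q` is at most its `L¹` distance to `φ`; this is the drift `δ
  -- n`.
  · have hc : ‖∫ z, q z‖ ≤ δ := by
      have h1 : ∫ z, q z = -∫ z, ((φ z : ℂ) - q z) := by
        rw [integral_sub hφc (hi q), integral_complex_ofReal, h0]
        simp
      rw [h1, norm_neg]
      exact (norm_integral_le_integral_norm _).trans hclose
    have h2 : |∑ k ∈ Finset.range n, (q (x + ((k * α : ℝ) : UnitAddCircle))).re|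
        ≤ ‖∑ k ∈ Finset.range n, q (x + ((k * α : ℝ) : UnitAddCircle))‖ := by
      rw [← Complex.re_sum]
      exact Complex.abs_re_le_norm _
    refine h2.trans ?_
    have h3 := norm_add_le (∑ k ∈ Finset.range n, q (x + ((k * α : ℝ) : UnitAddCircle))
      - n * ∫ z, q z) (n * ∫ z, q z)
    rw [sub_add_cancel, norm_mul, Complex.norm_natCast] at h3
    have h4 := mul_le_mul_of_nonneg_left hc (Nat.cast_nonneg (α := ℝ) n)
    linarith [hK n x, le_abs_self K]

/-! ### Increments of `f`: absolutely continuous part and jumps. -/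

theorem circleLift_periodic (f : UnitAddCircle → ℝ) : Function.Periodic (circleLift f) 1 :=
  fun x => by simp [circleLift]

theorem circleJump_of_leftContinuous {f : UnitAddCircle → ℝ} {y : ℝ}
    (hl : ContinuousWithinAt (circleLift f) (Iic y) y) :
    circleJump f y = Function.rightLim (circleLift f) y - circleLift f y := by
  rw [circleJump, hl.leftLim_eq]

theorem circleJump_eq_zero_of_continuousAt {f : UnitAddCircle → ℝ} {y : ℝ}
    (h : ContinuousAt f (y : UnitAddCircle)) : circleJump f y = 0 := by
  have hc : ContinuousAt (circleLift f) y :=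
    ContinuousAt.comp (f := ((↑) : ℝ → UnitAddCircle)) h
      (AddCircle.continuous_mk' 1).continuousAt
  rw [circleJump, hc.continuousWithinAt.leftLim_eq, hc.continuousWithinAt.rightLim_eq, sub_self]

/-- With a Jordan decomposition `F = p - q`, take `W = p + q`. -/
theorem BoundedVariationOn.exists_monotoneOn_abs_sub_le {F : ℝ → ℝ} {s : Set ℝ}
    (h : BoundedVariationOn F s) :
    ∃ W : ℝ → ℝ, MonotoneOn W s ∧ ∀ x ∈ s, ∀ y ∈ s, x ≤ y → |F y - F x| ≤ W y - W x := by
  obtain ⟨p, q, hp, hq, hpq⟩ := h.locallyBoundedVariationOn.exists_monotoneOn_sub_monotoneOn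
  refine ⟨p + q, hp.add hq, fun x hx y hy hxy => ?_⟩
  have h1 := hp hx hy hxy
  have h2 := hq hx hy hxy
  rw [hpq, abs_le]
  simp only [Pi.sub_apply, Pi.add_apply]
  constructor <;> linarith

theorem abs_rightLim_sub_le {F W : ℝ → ℝ} {a b y : ℝ} (hW : MonotoneOn W (Icc a b))
    (hFW : ∀ x ∈ Icc a b, ∀ y ∈ Icc a b, x ≤ y → |F y - F x| ≤ W y - W x)
    (hy : y ∈ Ico a b) : |Function.rightLim F y - F y| ≤ W b - W y := by
  have hb : b ∈ Icc a b := ⟨hy.1.trans hy.2.le, le_rfl⟩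
  by_cases h : ∃ l, Tendsto F (𝓝[>] y) (𝓝 l)
  · refine le_of_tendsto ((tendsto_rightLim_of_tendsto h).sub_const (F y)).abs ?_
    filter_upwards [Ioo_mem_nhdsGT hy.2] with z hz
    have hz' : z ∈ Icc a b := ⟨hy.1.trans hz.1.le, hz.2.le⟩
    exact (hFW y ⟨hy.1, hy.2.le⟩ z hz' hz.1.le).trans
      (sub_le_sub_right (hW hz' hb hz.2.le) _)
  -- Without a right limit, `rightLim F y` is by convention `F y`, so the jump is zero.
  · rw [rightLim_eq_of_not_tendsto F h, sub_self, abs_zero, sub_nonneg]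
    exact hW ⟨hy.1, hy.2.le⟩ hb hy.2.le

theorem sum_abs_rightLim_sub_le {F W : ℝ → ℝ} {a b : ℝ} (hab : a ≤ b)
    (hW : MonotoneOn W (Icc a b))
    (hFW : ∀ x ∈ Icc a b, ∀ y ∈ Icc a b, x ≤ y → |F y - F x| ≤ W y - W x) (s : Finset ℝ)
    (hs : ∀ y ∈ s, y ∈ Ico a b) : ∑ y ∈ s, |Function.rightLim F y - F y| ≤ W b - W a := by
  -- The jump at the largest point `y` is charged to `[y, b]`, all the others to `[a, y]`.
  induction s using Finset.induction_on_max generalizing b with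
  | empty => simpa using hW ⟨le_rfl, hab⟩ ⟨hab, le_rfl⟩ hab
  | insert y s hy ih =>
    have hyb : y ∈ Ico a b := hs y (Finset.mem_insert_self y s)
    have hsub : Icc a y ⊆ Icc a b := Icc_subset_Icc_right hyb.2.le
    have h1 := ih hyb.1 (hW.mono hsub) (fun x hx z hz => hFW x (hsub hx) z (hsub hz))
      (fun z hz => ⟨(hs z (Finset.mem_insert_of_mem hz)).1, hy z hz⟩)
    have h2 := abs_rightLim_sub_le hW hFW hyb
    rw [Finset.sum_insert fun h => (hy y h).false]
    linarith

theorem summable_circleJump {f : UnitAddCircle → ℝ} (hf : f ∈ classV) {ι : Type*} {β : ι → ℝ}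
    (hβ : ∀ i, β i ∈ Ico (0 : ℝ) 1) (hinj : Function.Injective β) :
    Summable fun i => |circleJump f (β i)| := by
  classical
  obtain ⟨W, hW, hFW⟩ := hf.2.1.exists_monotoneOn_abs_sub_le
  refine summable_of_sum_le (c := W 1 - W 0) (fun i => abs_nonneg _) fun u => ?_
  have h := sum_abs_rightLim_sub_le zero_le_one hW hFW (u.image β) (by
    intro y hy
    obtain ⟨i, -, rfl⟩ := Finset.mem_image.mp hy
    exact hβ i)
  rw [Finset.sum_image fun i _ j _ hij => hinj hij] at h
  refine le_trans (le_of_eq ?_) h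
  exact Finset.sum_congr rfl fun i _ => by rw [circleJump_of_leftContinuous (hf.1 _)]

theorem exists_forall_le_of_mem_classV {f : UnitAddCircle → ℝ} (hf : f ∈ classV) :
    ∃ M : ℝ, ∀ x, f x ≤ M := by
  obtain ⟨W, hW, hFW⟩ := hf.2.1.exists_monotoneOn_abs_sub_le
  refine ⟨circleLift f 0 + (W 1 - W 0), fun x => ?_⟩
  obtain ⟨t, ht, rfl⟩ : ∃ t ∈ Ico (0 : ℝ) 1, (t : UnitAddCircle) = x := by
    obtain ⟨t, ht, h⟩ := AddCircle.eq_coe_Ico x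
    exact ⟨t, by simpa using ht, h⟩
  have h0 : (0 : ℝ) ∈ Icc (0 : ℝ) 1 := by simp
  have h1 : (1 : ℝ) ∈ Icc (0 : ℝ) 1 := by simp
  have ht' : t ∈ Icc (0 : ℝ) 1 := ⟨ht.1, ht.2.le⟩
  have h2 := (le_abs_self _).trans (hFW 0 h0 t ht' ht.1)
  have h3 := hW ht' h1 ht.2.le
  change circleLift f t ≤ _
  linarith

theorem jumpPart_eq_tsum {f : UnitAddCircle → ℝ} {β : ℕ+ → ℝ} (hβ : ∀ i, β i ∈ Ico (0 : ℝ) 1)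
    (hinj : Function.Injective β)
    (hdisc : ∀ y ∈ Ico (0 : ℝ) 1, ¬ ContinuousAt f (y : UnitAddCircle) → y ∈ range β)
    {x : ℝ} (hx : x ≤ 1) :
    jumpPart f x = ∑' i, if β i < x then circleJump f (β i) else 0 := by
  classical
  rw [jumpPart, tsum_subtype (Ico 0 x) (circleJump f), ← hinj.tsum_eq]
  · refine tsum_congr fun i => ?_
    simp [indicator, (hβ i).1]
  · intro y hy
    rw [Function.mem_support, indicator_apply_ne_zero] at hy
    refine hdisc y ⟨hy.1.1, hy.1.2.trans_le hx⟩ fun hc => hy.2 ?_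
    exact circleJump_eq_zero_of_continuousAt hc

/-- The derivative of the continuous part of `f`, as a function on the circle. -/
noncomputable def continuousPartDeriv (f : UnitAddCircle → ℝ) : UnitAddCircle → ℝ :=
  AddCircle.liftIoc 1 0 (deriv (continuousPart f))

theorem integrable_continuousPartDeriv {f : UnitAddCircle → ℝ} (hf : f ∈ classV) :
    Integrable (continuousPartDeriv f) := by
  have h := hf.2.2.intervalIntegrable_deriv
  rw [intervalIntegrable_iff_integrableOn_Ioc_of_le zero_le_one] at h
  rw [← zero_add (1 : ℝ)] at h
  have h1 : MemLp (fun t => ((deriv (continuousPart f) t : ℝ) : ℂ)) 1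
      (volume.restrict (Ioc (0 : ℝ) (0 + 1))) := by
    rw [memLp_one_iff_integrable]
    exact Integrable.ofReal h
  have h2 := h1.memLp_liftIoc (T := 1)
  rw [memLp_one_iff_integrable] at h2
  exact h2.re

theorem integral_continuousPartDeriv {f : UnitAddCircle → ℝ} (hf : f ∈ classV) :
    ∫ z, continuousPartDeriv f z = slopeS f := by
  rw [continuousPartDeriv, AddCircle.integral_liftIoc_eq_intervalIntegral, zero_add,
    hf.2.2.integral_deriv_eq_sub, slopeS]

/-- The left side says that `b` lies in `[x, y)` modulo `1`. This half-open form matches left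
continuity: an increment from `x` to `y` sees a jump at `x` but not one at `y`. -/
theorem Int.fract_sub_lt_iff {b x y : ℝ} {m : ℤ} (hb : b ∈ Ico (0 : ℝ) 1) (hm : m ≤ x)
    (hy : y ≤ m + 1) : Int.fract (b - x) < y - x ↔ x - m ≤ b ∧ b < y - m := by
  constructor
  · intro h
    have h1 := Int.fract_nonneg (b - x)
    have h2 := Int.self_sub_fract (b - x)
    have h3 : ⌊b - x⌋ = -m := by
      have h4 : (⌊b - x⌋ : ℝ) < (-m : ℤ) + 1 := by push_cast; linarith [hb.2]
      have h5 : ((-m : ℤ) : ℝ) < ⌊b - x⌋ + 1 := by push_cast; linarith [hb.1]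
      have h6 : ⌊b - x⌋ < -m + 1 := by exact_mod_cast h4
      have h7 : -m < ⌊b - x⌋ + 1 := by exact_mod_cast h5
      omega
    rw [h3] at h2
    push_cast at h2
    constructor <;> linarith
  · rintro ⟨h1, h2⟩
    have : Int.fract (b - x) = b - x + m := by
      rw [Int.fract_eq_iff]
      refine ⟨by linarith, by linarith, -m, by push_cast; ring⟩
    rw [this]
    linarith

/-- The increment of `f` over an interval that contains no integer in its interior. -/
theorem circleLift_sub_circleLift {f : UnitAddCircle → ℝ} (hf : f ∈ classV) {β : ℕ+ → ℝ}
    (hβ : ∀ i, β i ∈ Ico (0 : ℝ) 1) (hinj : Function.Injective β)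
    (hdisc : ∀ y ∈ Ico (0 : ℝ) 1, ¬ ContinuousAt f (y : UnitAddCircle) → y ∈ range β)
    {x y : ℝ} {m : ℤ} (hm : m ≤ x) (hxy : x ≤ y) (hy : y ≤ m + 1) :
    circleLift f y - circleLift f x = (∫ t in x..y, continuousPartDeriv f (t : UnitAddCircle))
      + ∑' i, if Int.fract (β i - x) < y - x then circleJump f (β i) else 0 := by
  classical
  have hsum := (summable_circleJump hf hβ hinj).of_abs
  have hite : ∀ P : ℕ+ → Prop, Summable fun i => if P i then circleJump f (β i) else 0 := by
    intro P
    refine (hsum.indicator {i | P i}).congr fun i => ?_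
    simp [indicator]
  have hper : ∀ t, circleLift f (t - m) = circleLift f t := fun t => by
    simpa using (circleLift_periodic f).sub_int_mul_eq m (x := t)
  have hint : ∫ t in x..y, continuousPartDeriv f (t : UnitAddCircle)
      = continuousPart f (y - m) - continuousPart f (x - m) := by
    have hsub : uIcc (x - m) (y - m) ⊆ uIcc (0 : ℝ) 1 := by
      rw [uIcc_of_le (by linarith), uIcc_of_le zero_le_one]
      exact Icc_subset_Icc (by linarith) (by linarith)
    rw [← (hf.2.2.mono hsub).integral_deriv_eq_sub,
      intervalIntegral.integral_comp_sub_right (fun t => deriv (continuousPart f) t) (m : ℝ) |>.symm]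
    refine intervalIntegral.integral_congr_ae (.of_forall fun t ht => ?_)
    rw [uIoc_of_le hxy] at ht
    have h1 : ((t : ℝ) : UnitAddCircle) = ((t - m : ℝ) : UnitAddCircle) := by
      have h2 : ((m : ℝ) : UnitAddCircle) = 0 :=
        (AddCircle.coe_eq_zero_iff 1).mpr ⟨m, by simp⟩
      rw [AddCircle.coe_sub, h2, sub_zero]
    rw [h1, continuousPartDeriv, AddCircle.liftIoc_coe_apply]
    constructor <;> linarith [ht.1, ht.2]
  have hjump : (∑' i, if Int.fract (β i - x) < y - x then circleJump f (β i) else 0)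
      = jumpPart f (y - m) - jumpPart f (x - m) := by
    rw [jumpPart_eq_tsum hβ hinj hdisc (by linarith), jumpPart_eq_tsum hβ hinj hdisc (by linarith),
      ← (hite _).tsum_sub (hite _)]
    refine tsum_congr fun i => ?_
    rw [if_congr (Int.fract_sub_lt_iff (hβ i) hm hy) rfl rfl]
    by_cases h1 : β i < x - m
    · rw [if_neg (fun h => absurd h.1 (not_le.mpr h1)), if_pos h1, if_pos (by linarith), sub_self]
    · by_cases h2 : β i < y - m
      · rw [if_pos ⟨not_lt.mp h1, h2⟩, if_pos h2, if_neg h1, sub_zero]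
      · rw [if_neg (fun h => h2 h.2), if_neg h2, if_neg h1, sub_zero]
  rw [hint, hjump, ← hper y, ← hper x, continuousPart, continuousPart]
  ring

theorem measurable_of_discontinuities_subset_range {f : UnitAddCircle → ℝ} {β : ℕ+ → ℝ}
    (hdisc : ∀ y ∈ Ico (0 : ℝ) 1, ¬ ContinuousAt f (y : UnitAddCircle) → y ∈ range β) :
    Measurable f := by
  set s : Set UnitAddCircle := range fun i => (β i : UnitAddCircle)
  have hs : s.Countable := countable_range _
  refine measurable_of_restrict_of_restrict_compl hs.measurableSet ?_ ?_
  · have := hs.to_subtype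
    exact measurable_of_countable _
  · refine (continuousOn_iff_continuous_domRestrict.mp ?_).measurable
    intro x hx
    refine ContinuousAt.continuousWithinAt ?_
    by_contra hc
    obtain ⟨t, ht, rfl⟩ := AddCircle.eq_coe_Ico x
    obtain ⟨i, hi⟩ := hdisc t (by simpa using ht) hc
    exact hx ⟨i, by simp [hi]⟩

/-! ### Sums over translates of an interval with bounded overlap. -/

theorem MeasureTheory.Integrable.intervalIntegrable_coe_unitAddCircle {r : UnitAddCircle → ℝ}
    (hr : Integrable r) (a b : ℝ) :
    IntervalIntegrable (fun t : ℝ => r (t : UnitAddCircle)) volume a b := by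
  have hper : Function.Periodic (fun t : ℝ => r (t : UnitAddCircle)) 1 := fun t => by simp
  refine hper.intervalIntegrable one_ne_zero (t := 0) ?_ a b
  rw [intervalIntegrable_iff_integrableOn_Ioc_of_le (by simp)]
  exact (UnitAddCircle.measurePreserving_mk 0).integrable_comp_of_integrable hr

/-- If no point of the circle is covered by more than `M` of the translates `[x, y] + kα`, the
integrals of a nonnegative function over these translates add up to at most `M` times its total
integral. -/
theorem sum_intervalIntegral_le_mul_integral {r : UnitAddCircle → ℝ} (hr : Integrable r)
    (h0 : ∀ z, 0 ≤ r z) {α x y : ℝ} (hxy : x ≤ y) (hy : y - x < 1) {n M : ℕ}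
    (hcount : ∀ b : ℝ,
      ((Finset.range n).filter fun k : ℕ => Int.fract (b - k * α) ≤ y - x).card ≤ M) :
    ∑ k ∈ Finset.range n, ∫ t in (x + k * α)..(y + k * α), r (t : UnitAddCircle)
      ≤ M * ∫ z, r z := by
  -- Periodic indicators of the translates bring all integrals to the single period `[0, 1]`, where
  -- the sum is `r` times the number of translates covering the point.
  set w : ℕ → ℝ → ℝ := fun k =>
    indicator {t : ℝ | Int.fract (t - (x + k * α)) ≤ y - x} fun t => r (t : UnitAddCircle) with hw
  have hmeas : ∀ k : ℕ, MeasurableSet {t : ℝ | Int.fract (t - (x + k * α)) ≤ y - x} := fun k =>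
    measurableSet_le ((measurable_id.sub_const _).fract) measurable_const
  have hwint : ∀ k a b, IntervalIntegrable (w k) volume a b := fun k a b =>
    ⟨(hr.intervalIntegrable_coe_unitAddCircle a b).1.indicator (hmeas k),
      (hr.intervalIntegrable_coe_unitAddCircle a b).2.indicator (hmeas k)⟩
  have hw0 : ∀ k t, 0 ≤ w k t := fun k t => indicator_nonneg (fun _ _ => h0 _) t
  have hwper : ∀ k, Function.Periodic (w k) 1 := fun k t => by
    have h1 : Int.fract (t + 1 - (x + k * α)) = Int.fract (t - (x + k * α)) := by
      rw [add_sub_right_comm, Int.fract_add_one]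
    simp [hw, indicator, h1]
  have hk : ∀ k : ℕ, ∫ t in (x + k * α)..(y + k * α), r (t : UnitAddCircle)
      ≤ ∫ t in (0 : ℝ)..1, w k t := by
    intro k
    calc ∫ t in (x + k * α)..(y + k * α), r (t : UnitAddCircle)
        = ∫ t in (x + k * α)..(y + k * α), w k t := by
          refine intervalIntegral.integral_congr_ae (.of_forall fun t ht => ?_)
          rw [uIoc_of_le (by linarith)] at ht
          have h1 : Int.fract (t - (x + k * α)) = t - (x + k * α) :=
            Int.fract_eq_self.mpr ⟨by linarith [ht.1], by linarith [ht.2]⟩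
          rw [hw]
          simp only
          rw [indicator_of_mem]
          change Int.fract (t - (x + k * α)) ≤ y - x
          rw [h1]
          linarith [ht.2]
      _ ≤ ∫ t in (x + k * α)..(x + k * α + 1), w k t :=
          intervalIntegral.integral_mono_interval le_rfl (by linarith) (by linarith)
            (.of_forall (hw0 k)) (hwint k _ _)
      _ = ∫ t in (0 : ℝ)..1, w k t := by
          have := (hwper k).intervalIntegral_add_eq (x + k * α) 0
          rwa [zero_add] at this
  refine (Finset.sum_le_sum fun k _ => hk k).trans ?_
  rw [← intervalIntegral.integral_finsetSum fun k _ => hwint k 0 1,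
    ← UnitAddCircle.intervalIntegral_preimage 0 r, zero_add,
    ← intervalIntegral.integral_const_mul]
  have hsint := IntervalIntegrable.sum (Finset.range n) fun k _ => hwint k 0 1
  rw [Finset.sum_fn] at hsint
  refine intervalIntegral.integral_mono_on zero_le_one hsint
    ((hr.intervalIntegrable_coe_unitAddCircle 0 1).const_mul _) fun t _ => ?_
  have h2 : ∑ k ∈ Finset.range n, w k t
      = ((Finset.range n).filter fun k : ℕ => Int.fract (t - x - k * α) ≤ y - x).card
        * r (t : UnitAddCircle) := by
    rw [← nsmul_eq_mul, ← Finset.sum_const, Finset.sum_filter]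
    refine Finset.sum_congr rfl fun k _ => ?_
    simp [hw, indicator, sub_sub]
  rw [h2]
  exact mul_le_mul_of_nonneg_right (by exact_mod_cast hcount (t - x)) (h0 _)

/-- Interchange the sums: a jump with `A i` is met by at most `M` translates, any other jump by
none. -/
theorem abs_sum_tsum_ite_le {ι : Type*} {d β : ι → ℝ} (hd : Summable fun i => |d i|)
    {α x ℓ τ : ℝ} {n M : ℕ}
    (hcount : ∀ b : ℝ,
      ((Finset.range n).filter fun k : ℕ => Int.fract (b - k * α) ≤ ℓ).card ≤ M)
    {A : ι → Prop} (hA : ∀ i, ¬ A i → ∀ k < n, ¬ Int.fract (β i - (x + k * α)) < ℓ)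
    (hτ : ∑' i : {i // A i}, |d i| ≤ τ) :
    |∑ k ∈ Finset.range n, ∑' i, if Int.fract (β i - (x + k * α)) < ℓ then d i else 0|
      ≤ M * τ := by
  classical
  have hite : ∀ k : ℕ, Summable fun i =>
      if Int.fract (β i - (x + k * α)) < ℓ then d i else 0 := by
    intro k
    refine (hd.of_abs.indicator {i | Int.fract (β i - (x + k * α)) < ℓ}).congr fun i => ?_
    simp [indicator]
  have hind : Summable fun i => indicator {i | A i} (fun i => |d i|) i := hd.indicator _
  rw [← Summable.tsum_finsetSum fun k _ => hite k]
  have hb : ∀ i, ‖∑ k ∈ Finset.range n, if Int.fract (β i - (x + k * α)) < ℓ then d i else 0‖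
      ≤ M * indicator {i | A i} (fun i => |d i|) i := by
    intro i
    by_cases hi : A i
    · rw [indicator_of_mem (by exact hi), ← Finset.sum_filter, Finset.sum_const, nsmul_eq_mul,
        norm_mul, Real.norm_natCast, Real.norm_eq_abs]
      refine mul_le_mul_of_nonneg_right ?_ (abs_nonneg _)
      refine le_trans ?_ (Nat.cast_le.mpr (hcount (β i - x)))
      refine Nat.cast_le.mpr (Finset.card_le_card fun k hk => ?_)
      rw [Finset.mem_filter] at hk ⊢
      exact ⟨hk.1, by rw [sub_sub]; exact hk.2.le⟩
    · rw [indicator_of_notMem (by exact hi), mul_zero, norm_le_zero_iff]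
      refine Finset.sum_eq_zero fun k hk => ?_
      rw [if_neg (hA i hi k (Finset.mem_range.mp hk))]
  have h1 := tsum_of_norm_bounded (hind.mul_left (M : ℝ)).hasSum hb
  rw [Real.norm_eq_abs] at h1
  refine h1.trans ?_
  rw [tsum_mul_left]
  refine mul_le_mul_of_nonneg_left (le_trans (le_of_eq ?_) hτ) (Nat.cast_nonneg M)
  exact (tsum_subtype {i | A i} fun i => |d i|).symm

/-! ### Near-linearity of Birkhoff sums on a short interval. -/

/-- The Birkhoff sum `f(x) + f(x + α) + ⋯ + f(x + (n-1)α)`. -/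
noncomputable def rotationSum (f : UnitAddCircle → ℝ) (α : ℝ) (n : ℕ) (x : ℝ) : ℝ :=
  ∑ k ∈ Finset.range n, circleLift f (x + k * α)

/-- On an interval free of large discontinuities, a Birkhoff sum is almost linear with slope
`n S(f)`. -/
theorem abs_rotationSum_sub_le {f : UnitAddCircle → ℝ} (hf : f ∈ classV) {β : ℕ+ → ℝ}
    (hβ : ∀ i, β i ∈ Ico (0 : ℝ) 1) (hinj : Function.Injective β)
    (hdisc : ∀ y ∈ Ico (0 : ℝ) 1, ¬ ContinuousAt f (y : UnitAddCircle) → y ∈ range β)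
    {α x y δ K τ : ℝ} {n M : ℕ} (hxy : x ≤ y) (hy : y - x < 1) {p : C(UnitAddCircle, ℝ)}
    (hp : ∫ z, |continuousPartDeriv f z - slopeS f - p z| ≤ δ)
    (hpK : ∀ z : UnitAddCircle,
      |∑ k ∈ Finset.range n, p (z + ((k * α : ℝ) : UnitAddCircle))| ≤ K)
    (hcount : ∀ b : ℝ,
      ((Finset.range n).filter fun k : ℕ => Int.fract (b - k * α) ≤ y - x).card ≤ M)
    (hcell : ∀ k < n, ∃ m : ℤ, m ≤ x + k * α ∧ y + k * α ≤ m + 1)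
    {A : ℕ+ → Prop} (hA : ∀ i, ¬ A i → ∀ k < n, ¬ Int.fract (β i - (x + k * α)) < y - x)
    (hτ : ∑' i : {i // A i}, |circleJump f (β i)| ≤ τ) :
    |rotationSum f α n y - rotationSum f α n x - n * slopeS f * (y - x)|
      ≤ M * δ + K * (y - x) + M * τ := by
  have hpi : Integrable p volume :=
    p.continuous.integrable_of_hasCompactSupport (HasCompactSupport.of_compactSpace _)
  have hγ := integrable_continuousPartDeriv hf
  set r : UnitAddCircle → ℝ := fun z => continuousPartDeriv f z - slopeS f - p z with hr
  have hri : Integrable r := (hγ.sub (integrable_const _)).sub hpi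
  -- The derivative is written as `S(f) + p + r`. The constant gives the linear term; `r` is small
  -- in `L¹`, so overlap counting applies; `p` has small Birkhoff sums, integrated over length `y -
  -- x`.
  have hsplit : rotationSum f α n y - rotationSum f α n x - n * slopeS f * (y - x)
      = ∑ k ∈ Finset.range n, (∫ t in (x + k * α)..(y + k * α), r (t : UnitAddCircle))
        + ∑ k ∈ Finset.range n, (∫ t in (x + k * α)..(y + k * α), p (t : UnitAddCircle))
        + ∑ k ∈ Finset.range n,
          ∑' i, if Int.fract (β i - (x + k * α)) < y - x then circleJump f (β i) else 0 := by
    have h1 : (n : ℝ) * slopeS f * (y - x) = ∑ k ∈ Finset.range n, slopeS f * (y - x) := by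
      rw [Finset.sum_const, Finset.card_range, nsmul_eq_mul, mul_assoc]
    rw [rotationSum, rotationSum, h1, ← Finset.sum_sub_distrib, ← Finset.sum_sub_distrib,
      ← Finset.sum_add_distrib, ← Finset.sum_add_distrib]
    refine Finset.sum_congr rfl fun k hk => ?_
    obtain ⟨m, hm1, hm2⟩ := hcell k (Finset.mem_range.mp hk)
    rw [circleLift_sub_circleLift hf hβ hinj hdisc hm1 (by linarith) hm2,
      ← intervalIntegral.integral_add (hri.intervalIntegrable_coe_unitAddCircle _ _)
        (hpi.intervalIntegrable_coe_unitAddCircle _ _), add_sub_add_right_eq_sub]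
    have h2 : ∀ t : ℝ, r (t : UnitAddCircle) + p (t : UnitAddCircle)
        = continuousPartDeriv f (t : UnitAddCircle) - slopeS f := fun t => by
      rw [hr]; ring
    simp only [h2]
    rw [intervalIntegral.integral_sub (hγ.intervalIntegrable_coe_unitAddCircle _ _)
      intervalIntegrable_const, intervalIntegral.integral_const, smul_eq_mul]
    ring
  rw [hsplit]
  refine (abs_add_three _ _ _).trans (add_le_add (add_le_add ?_ ?_)
    (abs_sum_tsum_ite_le (summable_circleJump hf hβ hinj) hcount hA hτ))
  · calc |∑ k ∈ Finset.range n, ∫ t in (x + k * α)..(y + k * α), r (t : UnitAddCircle)|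
        ≤ ∑ k ∈ Finset.range n, ∫ t in (x + k * α)..(y + k * α), |r (t : UnitAddCircle)| := by
          refine (Finset.abs_sum_le_sum_abs _ _).trans (Finset.sum_le_sum fun k _ => ?_)
          exact intervalIntegral.abs_integral_le_integral_abs (by linarith)
      _ ≤ M * ∫ z, |r z| :=
          sum_intervalIntegral_le_mul_integral hri.abs (fun z => abs_nonneg _) hxy hy hcount
      _ ≤ M * δ := mul_le_mul_of_nonneg_left hp (Nat.cast_nonneg M)
  · have h1 : ∀ k : ℕ, ∫ t in (x + k * α)..(y + k * α), p (t : UnitAddCircle)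
        = ∫ t in x..y, p ((t : UnitAddCircle) + ((k * α : ℝ) : UnitAddCircle)) := by
      intro k
      rw [← intervalIntegral.integral_comp_add_right (fun t : ℝ => p (t : UnitAddCircle))]
      simp only [AddCircle.coe_add]
    simp only [h1]
    rw [← intervalIntegral.integral_finsetSum]
    · have h2 := intervalIntegral.norm_integral_le_of_norm_le_const (a := x) (b := y) (C := K)
        (f := fun t : ℝ =>
          ∑ k ∈ Finset.range n, p ((t : UnitAddCircle) + ((k * α : ℝ) : UnitAddCircle)))
        fun t _ => hpK t
      rwa [Real.norm_eq_abs, abs_of_nonneg (sub_nonneg.mpr hxy)] at h2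
    · intro k _
      refine Continuous.intervalIntegrable ?_ _ _
      exact p.continuous.comp ((AddCircle.continuous_mk' 1).add continuous_const)

/-! ### Measure estimate on one cell. -/

/-- If the functions `F n` are ordered with gaps at least `c` and almost linear with slopes `n S`
on a set of diameter at most `1 / J`, then few points of the set have some `F n` close to `t`. -/
theorem volume_exists_abs_sub_lt_le {I : Set ℝ} {F : ℕ → ℝ → ℝ} {c S ε e t L : ℝ} {J : ℕ}
    (hc : 0 < c) (hS : S ≠ 0) (hε : 0 ≤ ε) (he : 0 ≤ e) (hL : 0 < L) (hJ : 0 < J)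
    (hI : ∀ x ∈ I, ∀ y ∈ I, x ≤ y → y - x ≤ 1 / J)
    (hstep : ∀ n, ∀ x ∈ I, F n x + c ≤ F (n + 1) x)
    (hosc : ∀ n ≤ J, ∀ x ∈ I, ∀ y ∈ I, x ≤ y → |F n y - F n x - n * S * (y - x)| ≤ e)
    (hn : ∀ n, ∀ x ∈ I, |F n x - t| < ε → (J : ℝ) ≤ L * n ∧ n ≤ J) :
    volume {x ∈ I | ∃ n, |F n x - t| < ε} ≤
      ENNReal.ofReal ((2 * ((|S| + e + 2 * ε) / c) + 1) * (2 * ((2 * ε + e) * L / (J * |S|)))) := by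
  have hJ' : (0 : ℝ) < J := Nat.cast_pos.mpr hJ
  have hS' : 0 < |S| := abs_pos.mpr hS
  -- Over the set, the linear term of `F n₀` varies by at most `J |S| / J = |S|`, so any `F n x`
  -- within `ε` of `t` differs from `F n₀ x` by at most `|S| + e + 2ε`. Each index step costs at
  -- least `c`.
  set R := (|S| + e + 2 * ε) / c with hR
  -- For a fixed `n`, two admissible points satisfy `n |S| |x - x₁| ≤ 2ε + e`, and `n ≥ J / L`.
  set ρ := (2 * ε + e) * L / (J * |S|) with hρ
  have hR0 : 0 ≤ R := by positivity
  have hρ0 : 0 ≤ ρ := by positivity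
  rcases eq_empty_or_nonempty {x ∈ I | ∃ n, |F n x - t| < ε} with h | ⟨x₀, hx₀, n₀, hn₀⟩
  · rw [h, measure_empty]; exact zero_le
  have hosc' : ∀ n ≤ J, ∀ x ∈ I, ∀ y ∈ I, |F n y - F n x - n * S * (y - x)| ≤ e := by
    intro n hnJ x hx y hy
    rcases le_total x y with hxy | hxy
    · exact hosc n hnJ x hx y hy hxy
    · rw [← abs_neg]
      refine le_trans (le_of_eq ?_) (hosc n hnJ y hy x hx hxy)
      congr 1; ring
  have hI' : ∀ x ∈ I, ∀ y ∈ I, |y - x| ≤ 1 / J := by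
    intro x hx y hy
    rcases le_total x y with hxy | hxy
    · rw [abs_of_nonneg (by linarith)]; exact hI x hx y hy hxy
    · rw [abs_of_nonpos (by linarith)]; linarith [hI y hy x hx hxy]
  have hmono : ∀ x ∈ I, ∀ n m : ℕ, n ≤ m → F n x + c * (m - n) ≤ F m x := by
    intro x hx n m hnm
    induction m, hnm using Nat.le_induction with
    | base => simp
    | succ m _ ih => have := hstep m x hx; push_cast; linarith
  have hn₀J := (hn n₀ x₀ hx₀ hn₀).2
  have hwin : ∀ x ∈ I, ∀ n, |F n x - t| < ε → |(n : ℝ) - n₀| ≤ R := by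
    intro x hx n hnx
    have h1 := abs_le.mp (hosc' n₀ hn₀J x₀ hx₀ x hx)
    have h2 : |(n₀ : ℝ) * S * (x - x₀)| ≤ |S| := by
      rw [abs_mul, abs_mul, Nat.abs_cast]
      calc (n₀ : ℝ) * |S| * |x - x₀| ≤ J * |S| * (1 / J) := by
            gcongr
            exact hI' x₀ hx₀ x hx
        _ = |S| := by field_simp
    have h2' := abs_le.mp h2
    have h3 := abs_lt.mp hn₀
    have h4 := abs_lt.mp hnx
    rw [hR, le_div_iff₀ hc]
    rcases le_total n₀ n with h | h
    · have h5 := hmono x hx n₀ n h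
      rw [abs_of_nonneg (by simpa using h)]
      linarith
    · have h5 := hmono x hx n n₀ h
      rw [abs_of_nonpos (by simpa using h)]
      linarith
  have hdiam : ∀ n, volume {x ∈ I | |F n x - t| < ε} ≤ ENNReal.ofReal (2 * ρ) := by
    intro n
    rcases eq_empty_or_nonempty {x ∈ I | |F n x - t| < ε} with h | ⟨x₁, hx₁, hnx₁⟩
    · rw [h, measure_empty]; exact zero_le
    have hsub : {x ∈ I | |F n x - t| < ε} ⊆ Icc (x₁ - ρ) (x₁ + ρ) := by
      rintro x ⟨hx, hnx⟩
      obtain ⟨h1, h2⟩ := hn n x hx hnx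
      have h3 := abs_le.mp (hosc' n h2 x₁ hx₁ x hx)
      have h4 := abs_lt.mp hnx
      have h5 := abs_lt.mp hnx₁
      have h6 : |(n : ℝ) * S * (x - x₁)| ≤ 2 * ε + e := by
        rw [abs_le]; constructor <;> linarith
      rw [abs_mul, abs_mul, Nat.abs_cast] at h6
      have h7 : |x - x₁| ≤ ρ := by
        rw [hρ, le_div_iff₀ (by positivity)]
        calc |x - x₁| * (J * |S|) ≤ |x - x₁| * (L * n * |S|) := by gcongr
          _ = n * |S| * |x - x₁| * L := by ring
          _ ≤ (2 * ε + e) * L := by gcongr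
      have h8 := abs_le.mp h7
      constructor <;> linarith
    refine (measure_mono hsub).trans ?_
    rw [Real.volume_Icc]
    exact ENNReal.ofReal_le_ofReal (by linarith)
  have hcover : {x ∈ I | ∃ n, |F n x - t| < ε} ⊆
      ⋃ n ∈ Finset.Icc (n₀ - ⌊R⌋₊) (n₀ + ⌊R⌋₊), {x ∈ I | |F n x - t| < ε} := by
    rintro x ⟨hx, n, hnx⟩
    have h1 := abs_le.mp (hwin x hx n hnx)
    have h2 : n ≤ n₀ + ⌊R⌋₊ := by
      rcases le_total n n₀ with h | h
      · omega
      · have : ((n - n₀ : ℕ) : ℝ) ≤ R := by rw [Nat.cast_sub h]; linarith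
        have := Nat.le_floor this
        omega
    have h3 : n₀ - ⌊R⌋₊ ≤ n := by
      rcases le_total n₀ n with h | h
      · omega
      · have : ((n₀ - n : ℕ) : ℝ) ≤ R := by rw [Nat.cast_sub h]; linarith
        have := Nat.le_floor this
        omega
    exact mem_biUnion (Finset.mem_coe.mpr (Finset.mem_Icc.mpr ⟨h3, h2⟩)) ⟨hx, hnx⟩
  calc volume {x ∈ I | ∃ n, |F n x - t| < ε}
      ≤ ∑ n ∈ Finset.Icc (n₀ - ⌊R⌋₊) (n₀ + ⌊R⌋₊), volume {x ∈ I | |F n x - t| < ε} :=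
        (measure_mono hcover).trans (measure_biUnion_finset_le _ _)
    _ ≤ ∑ n ∈ Finset.Icc (n₀ - ⌊R⌋₊) (n₀ + ⌊R⌋₊), ENNReal.ofReal (2 * ρ) :=
        Finset.sum_le_sum fun n _ => hdiam n
    _ = (Finset.Icc (n₀ - ⌊R⌋₊) (n₀ + ⌊R⌋₊)).card * ENNReal.ofReal (2 * ρ) := by
        rw [Finset.sum_const, nsmul_eq_mul]
    _ ≤ ENNReal.ofReal (2 * R + 1) * ENNReal.ofReal (2 * ρ) := by
        gcongr
        rw [← ENNReal.ofReal_natCast]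
        refine ENNReal.ofReal_le_ofReal ?_
        have h1 : (Finset.Icc (n₀ - ⌊R⌋₊) (n₀ + ⌊R⌋₊)).card ≤ 2 * ⌊R⌋₊ + 1 := by
          rw [Nat.card_Icc]; omega
        have h2 := Nat.floor_le hR0
        have h3 : ((Finset.Icc (n₀ - ⌊R⌋₊) (n₀ + ⌊R⌋₊)).card : ℝ) ≤ 2 * ⌊R⌋₊ + 1 := by
          exact_mod_cast h1
        linarith
    _ = _ := by rw [← ENNReal.ofReal_mul (by positivity)]

/-! ### The partition of the circle. -/

/-- The half-open interval to the right of `z` in the partition by the points of `Z`. -/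
def partitionCell (Z : Finset ℝ) (z : ℝ) : Set ℝ :=
  {x | x ≤ 1 ∧ z < x ∧ ∀ w ∈ Z, w < x → w ≤ z}

/-- A point of `(0, 1]` lies in the cell of the largest cut point below it, which exists because `0
∈ Z`. -/
theorem volume_le_card_mul_of_partitionCell {Z : Finset ℝ} (h0 : (0 : ℝ) ∈ Z) {B : Set ℝ}
    {v : ENNReal} (hv : ∀ z ∈ Z, volume (partitionCell Z z ∩ B) ≤ v) :
    volume (Ioc 0 1 ∩ B) ≤ Z.card * v := by
  have hcover : Ioc 0 1 ∩ B ⊆ ⋃ z ∈ Z, partitionCell Z z ∩ B := by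
    rintro x ⟨⟨hx0, hx1⟩, hxB⟩
    have hne : (Z.filter (· < x)).Nonempty := ⟨0, Finset.mem_filter.mpr ⟨h0, hx0⟩⟩
    have hmem := Finset.mem_filter.mp (Finset.max'_mem _ hne)
    refine mem_biUnion (Finset.mem_coe.mpr hmem.1) ⟨⟨hx1, hmem.2, fun w hw hwx => ?_⟩, hxB⟩
    exact Finset.le_max' _ _ (Finset.mem_filter.mpr ⟨hw, hwx⟩)
  calc volume (Ioc 0 1 ∩ B) ≤ ∑ z ∈ Z, volume (partitionCell Z z ∩ B) :=
        (measure_mono hcover).trans (measure_biUnion_finset_le _ _)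
    _ ≤ ∑ z ∈ Z, v := Finset.sum_le_sum hv
    _ = Z.card * v := by rw [Finset.sum_const, nsmul_eq_mul]

theorem lt_of_mem_partitionCell {Z : Finset ℝ} {z x y w : ℝ} (hx : x ∈ partitionCell Z z)
    (hy : y ∈ partitionCell Z z) (hw : w ∈ Z) (hxw : x ≤ w) : y ≤ w := by
  by_contra! h
  have := hy.2.2 w hw h
  linarith [hx.2.1]

/-- The points `-kα`, `β i - kα` and `k / J` of the circle, for `k < J` and `i ∈ H`. -/
noncomputable def cutPoints {ι : Type*} (α : ℝ) (β : ι → ℝ) (H : Finset ι) (J : ℕ) : Finset ℝ := by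
  classical
  exact (Finset.range J).image (fun k : ℕ => Int.fract (-(k * α)))
    ∪ (H ×ˢ Finset.range J).image (fun q : ι × ℕ => Int.fract (β q.1 - q.2 * α))
    ∪ (Finset.range J).image (fun k : ℕ => (k : ℝ) / J)

section cutPoints

variable {ι : Type*} {α : ℝ} {β : ι → ℝ} {H : Finset ι} {J : ℕ}

theorem card_cutPoints_le : (cutPoints α β H J).card ≤ (H.card + 2) * J := by
  classical
  unfold cutPoints
  refine (Finset.card_union_le _ _).trans ?_
  refine (add_le_add ((Finset.card_union_le _ _).trans
    (add_le_add Finset.card_image_le Finset.card_image_le)) Finset.card_image_le).trans ?_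
  rw [Finset.card_product, Finset.card_range]
  linarith

theorem fract_neg_mem_cutPoints {k : ℕ} (hk : k < J) :
    Int.fract (-(k * α)) ∈ cutPoints α β H J := by
  classical
  unfold cutPoints
  exact Finset.mem_union_left _ (Finset.mem_union_left _
    (Finset.mem_image.mpr ⟨k, Finset.mem_range.mpr hk, rfl⟩))

theorem fract_sub_mem_cutPoints {i : ι} (hi : i ∈ H) {k : ℕ} (hk : k < J) :
    Int.fract (β i - k * α) ∈ cutPoints α β H J := by
  classical
  unfold cutPoints
  exact Finset.mem_union_left _ (Finset.mem_union_right _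
    (Finset.mem_image.mpr ⟨(i, k), Finset.mk_mem_product hi (Finset.mem_range.mpr hk), rfl⟩))

theorem natCast_div_mem_cutPoints {k : ℕ} (hk : k < J) : (k : ℝ) / J ∈ cutPoints α β H J := by
  classical
  unfold cutPoints
  exact Finset.mem_union_right _ (Finset.mem_image.mpr ⟨k, Finset.mem_range.mpr hk, rfl⟩)

theorem nonneg_of_mem_cutPoints {z : ℝ} (hz : z ∈ cutPoints α β H J) : 0 ≤ z := by
  classical
  unfold cutPoints at hz
  simp only [Finset.mem_union, Finset.mem_image] at hz
  rcases hz with (⟨k, -, rfl⟩ | ⟨q, -, rfl⟩) | ⟨k, -, rfl⟩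
  · exact Int.fract_nonneg _
  · exact Int.fract_nonneg _
  · positivity

/-- Otherwise the cut point `⌈x J⌉ / J` would separate `x` from `y`. -/
theorem sub_le_of_mem_partitionCell_cutPoints {z x y : ℝ}
    (hz : z ∈ cutPoints α β H J) (hx : x ∈ partitionCell (cutPoints α β H J) z)
    (hy : y ∈ partitionCell (cutPoints α β H J) z) (hJ : 0 < J) :
    y - x ≤ 1 / J := by
  have hJ' : (0 : ℝ) < J := Nat.cast_pos.mpr hJ
  have hx0 : 0 < x := (nonneg_of_mem_cutPoints hz).trans_lt hx.2.1
  by_contra! h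
  have h1 : 1 < (y - x) * J := by rwa [div_lt_iff₀ hJ'] at h
  have h2 := Nat.ceil_lt_add_one (mul_nonneg hx0.le hJ'.le)
  have h3 := Nat.le_ceil (x * J)
  have hyJ : y * J ≤ J := by nlinarith [hy.1]
  have h4 : ⌈x * J⌉₊ < J := by
    have : (⌈x * J⌉₊ : ℝ) < J := by linarith
    exact_mod_cast this
  have h5 := lt_of_mem_partitionCell hx hy (natCast_div_mem_cutPoints h4)
    ((le_div_iff₀ hJ').mpr h3)
  rw [le_div_iff₀ hJ'] at h5
  linarith

/-- An integer strictly between `x + kα` and `y + kα` would put the cut point `-kα` between `x` and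
`y`. -/
theorem exists_int_of_mem_partitionCell_cutPoints {z x y : ℝ}
    (hz : z ∈ cutPoints α β H J) (hx : x ∈ partitionCell (cutPoints α β H J) z)
    (hy : y ∈ partitionCell (cutPoints α β H J) z) {k : ℕ} (hk : k < J) :
    ∃ m : ℤ, m ≤ x + k * α ∧ y + k * α ≤ m + 1 := by
  have hx0 : 0 < x := (nonneg_of_mem_cutPoints hz).trans_lt hx.2.1
  refine ⟨⌈y + k * α⌉ - 1, ?_, ?_⟩
  · by_contra! h
    push_cast at h
    have h1 := Int.ceil_lt_add_one (y + k * α)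
    have hy1 := hy.1
    have h2 : Int.fract (-(k * α)) = (⌈y + k * α⌉ - 1 : ℝ) - k * α := by
      rw [Int.fract_eq_iff]
      refine ⟨by linarith, by linarith, -(⌈y + k * α⌉ - 1), by push_cast; ring⟩
    have h3 := lt_of_mem_partitionCell hx hy (fract_neg_mem_cutPoints hk) (by rw [h2]; linarith)
    rw [h2] at h3
    linarith
  · push_cast
    linarith [Int.le_ceil (y + k * α)]

/-- A hit would put the cut point `β i - kα` in `[x, y)`. -/
theorem not_fract_lt_of_mem_partitionCell_cutPoints {z x y : ℝ}
    (hz : z ∈ cutPoints α β H J) (hx : x ∈ partitionCell (cutPoints α β H J) z)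
    (hy : y ∈ partitionCell (cutPoints α β H J) z) {i : ι} (hi : i ∈ H)
    {k : ℕ} (hk : k < J) : ¬ Int.fract (β i - (x + k * α)) < y - x := by
  intro h
  have hx0 : 0 < x := (nonneg_of_mem_cutPoints hz).trans_lt hx.2.1
  have h0 := Int.fract_nonneg (β i - (x + k * α))
  have hy1 := hy.1
  have h2 : Int.fract (β i - k * α) = x + Int.fract (β i - (x + k * α)) := by
    rw [Int.fract_eq_iff]
    refine ⟨by linarith, by linarith, ⌊β i - (x + k * α)⌋, by simp only [Int.fract]; ring⟩
  have h3 := lt_of_mem_partitionCell hx hy (fract_sub_mem_cutPoints hi hk) (by rw [h2]; linarith)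
  rw [h2] at h3
  linarith

end cutPoints

/-! ### Measure of the points with a Birkhoff sum near `t`. -/

theorem rotationSum_succ (f : UnitAddCircle → ℝ) (α : ℝ) (n : ℕ) (x : ℝ) :
    rotationSum f α (n + 1) x = rotationSum f α n x + circleLift f (x + n * α) :=
  Finset.sum_range_succ _ _

theorem natCast_mul_le_rotationSum {f : UnitAddCircle → ℝ} {c : ℝ} (hc : ∀ x, c ≤ f x) (α : ℝ)
    (n : ℕ) (x : ℝ) : n * c ≤ rotationSum f α n x := by
  have := Finset.card_nsmul_le_sum (Finset.range n) (fun k : ℕ => circleLift f (x + k * α)) c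
    fun k _ => hc _
  rw [Finset.card_range, nsmul_eq_mul] at this
  exact this

theorem rotationSum_le_natCast_mul {f : UnitAddCircle → ℝ} {b : ℝ} (hb : ∀ x, f x ≤ b) (α : ℝ)
    (n : ℕ) (x : ℝ) : rotationSum f α n x ≤ n * b := by
  have := Finset.sum_le_card_nsmul (Finset.range n) (fun k : ℕ => circleLift f (x + k * α)) b
    fun k _ => hb _
  rw [Finset.card_range, nsmul_eq_mul] at this
  exact this

/-- The set of points one of whose Birkhoff sums lies within `ε` of a large time `t` has measure
at most a constant times `ε` times the number of discontinuities that are not negligible. -/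
theorem exists_volume_abs_rotationSum_sub_lt_le {f : UnitAddCircle → ℝ} (hf : f ∈ classU)
    {c : ℝ} (hc : 0 < c) (hcf : ∀ x, c ≤ f x) {β : ℕ+ → ℝ}
    (hβ : ∀ i, β i ∈ Ico (0 : ℝ) 1) (hinj : Function.Injective β)
    (hdisc : ∀ y ∈ Ico (0 : ℝ) 1, ¬ ContinuousAt f (y : UnitAddCircle) → y ∈ range β)
    {α : ℝ} (hα : Irrational α) {C : ℝ} (hC : 0 < C)
    (hsep : ∀ k : ℕ, ∀ i < k, ∀ j < k, i ≠ j → C / k ≤ Int.fract ((i : ℝ) * α - j * α)) :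
    ∃ D : ℝ, 0 ≤ D ∧ ∀ ε : ℝ, 0 < ε → ε ≤ 1 → ∀ (A : ℕ+ → Prop) (H : Finset ℕ+),
      (∀ i, ¬ A i → i ∈ H) → ∑' i : {i // A i}, |circleJump f (β i)| ≤ ε →
      ∀ᶠ t in atTop, volume (Ioc (0 : ℝ) 1 ∩ {x | ∃ n, |rotationSum f α n x - t| < ε})
        ≤ ENNReal.ofReal (D * (H.card + 2) * ε) := by
  obtain ⟨hfV, hS⟩ := hf
  obtain ⟨b, hb⟩ := exists_forall_le_of_mem_classV hfV
  set S := slopeS f with hSdef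
  have hS' : 0 < |S| := abs_pos.mpr hS
  have hb0 : 0 < b := hc.trans_le ((hcf 0).trans (hb 0))
  -- Overlap bound: cells of length at most `1 / J` against orbit points that are `C / J`-separated.
  set M : ℕ := ⌊1 / C⌋₊ + 1 with hM
  -- From `n b ≥ t - 1 ≥ t / 2` and `J ≤ 3 t / c` one gets `J ≤ L n`.
  set L : ℝ := 6 * b / c with hL
  have hL0 : 0 < L := by positivity
  refine ⟨(2 * ((|S| + (2 * M + 4)) / c) + 1) * (2 * ((2 * M + 4) * L / |S|)), by positivity,
    fun ε hε hε1 A H hAH hAε => ?_⟩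
  have hφ0 : ∫ z, (continuousPartDeriv f z - S) = 0 := by
    rw [integral_sub (integrable_continuousPartDeriv hfV) (integrable_const _),
      integral_continuousPartDeriv hfV]
    simp [hSdef, measureReal_def]
  obtain ⟨p, hp, K, hK0, hpK⟩ := exists_continuous_approx_sum_le hα
    ((integrable_continuousPartDeriv hfV).sub (integrable_const S)) hφ0 hε
  filter_upwards [eventually_ge_atTop 3, eventually_ge_atTop (2 * c),
    eventually_ge_atTop (c * (K / ε))] with t ht3 htc htK
  -- A Birkhoff sum below `t + 1` has at most `(t + 1) / c` terms.
  set J : ℕ := ⌈(t + 1) / c⌉₊ with hJdef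
  have hJle : (t + 1) / c ≤ J := Nat.le_ceil _
  have hJlt : (J : ℝ) < (t + 1) / c + 1 := Nat.ceil_lt_add_one (by positivity)
  have hJ2 : (2 : ℝ) < J := by
    refine lt_of_lt_of_le ?_ hJle
    rw [lt_div_iff₀ hc]; linarith
  have hJpos : (0 : ℝ) < J := by linarith
  have hJ0 : 0 < J := Nat.cast_pos.mp hJpos
  have hJK : K ≤ ε * J := by
    have h1 : K / ε ≤ J := by
      refine le_trans ?_ hJle
      rw [le_div_iff₀ hc]; linarith
    rw [div_le_iff₀ hε] at h1
    linarith
  -- `M ε` from the `L¹` error, `2 ε` from `p` (sums at most `ε J + K ≤ 2 ε J`, length at most `1 /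
  -- J`) and `M ε` from the small jumps.
  set e : ℝ := (2 * M + 2) * ε with he
  have hZ0 : (0 : ℝ) ∈ cutPoints α β H J := by
    have := natCast_div_mem_cutPoints (α := α) (β := β) (H := H) hJ0
    simpa using this
  have hcell : ∀ z ∈ cutPoints α β H J,
      volume (partitionCell (cutPoints α β H J) z ∩ {x | ∃ n, |rotationSum f α n x - t| < ε}) ≤
        ENNReal.ofReal ((2 * ((|S| + e + 2 * ε) / c) + 1)
          * (2 * ((2 * ε + e) * L / (J * |S|)))) := by
    intro z hz
    refine volume_exists_abs_sub_lt_le (F := rotationSum f α) hc hS hε.le (by positivity) hL0 hJ0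
      (fun x hx y hy _ => sub_le_of_mem_partitionCell_cutPoints hz hx hy hJ0) ?_ ?_ ?_
    · intro n x _
      rw [rotationSum_succ]
      have := hcf ((x + n * α : ℝ) : UnitAddCircle)
      change _ ≤ _ + f _
      linarith
    · intro n hn x hx y hy hxy
      have hyx := sub_le_of_mem_partitionCell_cutPoints hz hx hy hJ0
      have hyx1 : y - x < 1 := by
        refine hyx.trans_lt ?_
        rw [div_lt_one hJpos]; linarith
      have hn' : (n : ℝ) ≤ J := Nat.cast_le.mpr hn
      refine (abs_rotationSum_sub_le hfV hβ hinj hdisc (M := M) hxy hyx1 hp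
        (fun z => (hpK n z).trans (add_le_add_left (mul_le_mul_of_nonneg_left hn' hε.le) K)) ?_
        (fun k hk => exists_int_of_mem_partitionCell_cutPoints hz hx hy (hk.trans_le hn))
        (fun i hi k hk => not_fract_lt_of_mem_partitionCell_cutPoints hz hx hy (hAH i hi)
          (hk.trans_le hn)) hAε).trans ?_
      · intro a
        refine (Finset.card_le_card (Finset.filter_subset_filter _
          (Finset.range_mono hn))).trans ?_
        refine (card_filter_fract_le (div_pos hC hJpos) (hsep J) a (y - x)).trans ?_
        refine Nat.succ_le_succ (Nat.floor_le_floor ?_)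
        rw [div_div_eq_mul_div]
        refine div_le_div_of_nonneg_right ?_ hC.le
        rwa [le_div_iff₀ hJpos] at hyx
      · have h1 : (ε * J + K) * (y - x) ≤ 2 * ε := by
          calc (ε * J + K) * (y - x) ≤ (ε * J + ε * J) * (1 / J) := by
                gcongr
            _ = 2 * ε := by field_simp; norm_num
        linarith
    · intro n x _ hnx
      have h1 := natCast_mul_le_rotationSum hcf α n x
      have h2 := rotationSum_le_natCast_mul hb α n x
      have h3 := abs_lt.mp hnx
      constructor
      · have h4 : (t + 1) / c + 1 ≤ 3 * t / c := by
          rw [div_add_one hc.ne']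
          refine div_le_div_of_nonneg_right ?_ hc.le
          linarith
        have h5 : 3 * t / c ≤ L * n := by
          rw [hL, div_mul_eq_mul_div]
          refine div_le_div_of_nonneg_right ?_ hc.le
          linarith
        linarith
      · have h4 : (n : ℝ) ≤ (t + 1) / c := by
          rw [le_div_iff₀ hc]; linarith
        exact_mod_cast h4.trans hJle
  refine (volume_le_card_mul_of_partitionCell hZ0 hcell).trans ?_
  rw [← ENNReal.ofReal_natCast, ← ENNReal.ofReal_mul (Nat.cast_nonneg _)]
  refine ENNReal.ofReal_le_ofReal ?_
  have hcard : ((cutPoints α β H J).card : ℝ) ≤ (H.card + 2) * J := by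
    exact_mod_cast card_cutPoints_le
  have h1 : 2 * ((|S| + e + 2 * ε) / c) + 1 ≤ 2 * ((|S| + (2 * M + 4)) / c) + 1 := by
    have h2 : (2 * (M : ℝ) + 4) * ε ≤ 2 * M + 4 := mul_le_of_le_one_right (by positivity) hε1
    have h3 : |S| + e + 2 * ε ≤ |S| + (2 * M + 4) := by rw [he]; linarith
    gcongr
  calc ((cutPoints α β H J).card : ℝ) * ((2 * ((|S| + e + 2 * ε) / c) + 1)
          * (2 * ((2 * ε + e) * L / (J * |S|))))
      ≤ ((H.card + 2) * J) * ((2 * ((|S| + (2 * M + 4)) / c) + 1)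
          * (2 * ((2 * ε + e) * L / (J * |S|)))) := by gcongr
    _ = (2 * ((|S| + (2 * M + 4)) / c) + 1) * (2 * ((2 * M + 4) * L / |S|)) * (H.card + 2) * ε := by
        rw [he]
        field_simp
        ring

/-! ### The bottom strip of the special flow. -/

theorem cocycleSum_circleRotation_natCast (α : ℝ) (f : UnitAddCircle → ℝ) (n : ℕ) (x : ℝ) :
    cocycleSum (circleRotation α) f n (x : UnitAddCircle) = rotationSum f α n x := by
  induction n with
  | zero => simp [cocycleSum_zero, rotationSum]
  | succ n ih =>
    rw [Nat.cast_succ, cocycleSum_add_one, ih, rotationSum_succ, circleLift]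
    congr 2
    have : ∀ m : ℕ, (circleRotation α ^ m) (x : UnitAddCircle) = ((x + m * α : ℝ) :) := by
      intro m
      induction m with
      | zero => simp
      | succ m ihm =>
        rw [pow_succ', Equiv.Perm.mul_apply, ihm, circleRotation, Equiv.coe_addRight]
        change ((x + m * α : ℝ) : UnitAddCircle) + (α : UnitAddCircle) = _
        rw [← AddCircle.coe_add]
        congr 1
        push_cast
        ring
    exact_mod_cast this n

theorem cocycleSum_nonpos {X : Type*} {T : Equiv.Perm X} {f : X → ℝ} (hf : ∀ x, 0 ≤ f x) {n : ℤ}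
    (hn : n ≤ 0) (x : X) : cocycleSum T f n x ≤ 0 := by
  rw [cocycleSum, Finset.Ico_eq_empty (by omega), Finset.sum_empty, zero_sub, neg_nonpos]
  exact Finset.sum_nonneg fun k _ => hf _

/-- A point below height `ε` that is below height `ε` again at time `t` has a Birkhoff sum
`ε`-close to `t`. -/
theorem specialMeasure_bottom_inter_preimage_le {f : UnitAddCircle → ℝ} (hfm : Measurable f)
    (hf : ∃ c > 0, ∀ x, c ≤ f x) (α : ℝ) {ε t : ℝ} (hεt : ε < t) :
    specialMeasure volume f ({q | q.1.2 < ε} ∩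
        specialFlow (circleRotation α) f hf t ⁻¹' {q | q.1.2 < ε})
      ≤ volume (Ioc (0 : ℝ) 1 ∩ {x | ∃ n, |rotationSum f α n x - t| < ε}) * ENNReal.ofReal ε := by
  have hspace : MeasurableSet (specialSpace f) :=
    (measurableSet_le measurable_const measurable_snd).inter
      (measurableSet_lt measurable_snd (hfm.comp measurable_fst))
  obtain ⟨c, hc, hcf⟩ := id hf
  set E : Set UnitAddCircle :=
    {z | ∃ n : ℕ, |cocycleSum (circleRotation α) f n z - t| < ε} with hE
  have hcm : ∀ n : ℕ, Measurable fun z => cocycleSum (circleRotation α) f n z := by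
    intro n
    have hT : ∀ m : ℕ, Measurable fun z => (circleRotation α ^ (m : ℤ)) z := by
      intro m
      induction m with
      | zero =>
        simp only [Nat.cast_zero, zpow_zero, Equiv.Perm.coe_one, id]
        exact measurable_id
      | succ m ih =>
        have : (fun z => (circleRotation α ^ ((m + 1 : ℕ) : ℤ)) z)
            = fun z => (circleRotation α ^ (m : ℤ)) z + (α : UnitAddCircle) := by
          funext z
          rw [zpow_natCast, zpow_natCast, pow_succ', Equiv.Perm.mul_apply, circleRotation,
            Equiv.coe_addRight]
        rw [this]
        exact ih.add_const _
    induction n with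
    | zero => simp [cocycleSum_zero]
    | succ n ih =>
      simp only [Nat.cast_succ, cocycleSum_add_one]
      exact ih.add (hfm.comp (hT n))
  have hEm : MeasurableSet E := by
    have : E = ⋃ n : ℕ, {z | |cocycleSum (circleRotation α) f n z - t| < ε} := by
      ext z; simp [hE]
    rw [this]
    exact MeasurableSet.iUnion fun n =>
      measurableSet_lt ((hcm n).sub_const t).norm measurable_const
  have hEvol : volume E
      = volume (Ioc (0 : ℝ) 1 ∩ {x | ∃ n, |rotationSum f α n x - t| < ε}) := by
    have h := AddCircle.add_projection_respects_measure 1 0 hEm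
    rw [h, zero_add, inter_comm]
    congr 2
    ext x
    change (∃ n : ℕ, |cocycleSum (circleRotation α) f n (x : UnitAddCircle) - t| < ε) ↔ _
    simp only [cocycleSum_circleRotation_natCast]
    rfl
  rw [specialMeasure, (MeasurableEmbedding.subtype_coe hspace).comap_apply, ← hEvol]
  have hsub : Subtype.val '' ({q : specialSpace f | q.1.2 < ε} ∩
      specialFlow (circleRotation α) f hf t ⁻¹' {q | q.1.2 < ε}) ⊆ E ×ˢ Ico 0 ε := by
    rintro _ ⟨q, ⟨hq1, hq2⟩, rfl⟩
    have hq0 := q.2.1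
    refine ⟨?_, hq0, hq1⟩
    set w := specialFlow (circleRotation α) f hf t q with hw
    have hw0 : 0 ≤ w.1.2 := w.2.1
    have hw1 : w.1.2 < ε := hq2
    obtain ⟨n, hn⟩ : ∃ n : ℤ, w.1.2 = q.1.2 + t - cocycleSum (circleRotation α) f n q.1.1 :=
      ⟨_, rfl⟩
    have hq1' : q.1.2 < ε := hq1
    -- For `n < 0` the new height would be at least `t > ε`.
    have hn0 : 0 ≤ n := by
      by_contra! h
      have := cocycleSum_nonpos (T := circleRotation α) (fun x => hc.le.trans (hcf x)) h.le q.1.1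
      linarith
    lift n to ℕ using hn0
    -- `f⁽ⁿ⁾ - t` is the old height minus the new one, both in `[0, ε)`.
    refine ⟨n, ?_⟩
    rw [abs_lt]
    constructor <;> linarith
  refine (measure_mono hsub).trans ?_
  rw [Measure.prod_prod, Real.volume_Ico, sub_zero]

theorem specialMeasure_bottom {f : UnitAddCircle → ℝ} (hfm : Measurable f) {ε : ℝ}
    (hε : ∀ x, ε ≤ f x) :
    specialMeasure volume f {q | q.1.2 < ε} = ENNReal.ofReal ε := by
  have hspace : MeasurableSet (specialSpace f) :=
    (measurableSet_le measurable_const measurable_snd).inter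
      (measurableSet_lt measurable_snd (hfm.comp measurable_fst))
  have himg : Subtype.val '' {q : specialSpace f | q.1.2 < ε} = univ ×ˢ Ico 0 ε := by
    ext ⟨x, s⟩
    constructor
    · rintro ⟨q, hq, h⟩
      have h0 := q.2.1
      rw [h] at h0
      have h1 : q.1.2 < ε := hq
      rw [h] at h1
      exact ⟨trivial, h0, h1⟩
    · rintro ⟨-, h0, h1⟩
      exact ⟨⟨(x, s), h0, lt_of_lt_of_le h1 (hε x)⟩, h1, rfl⟩
  rw [specialMeasure, (MeasurableEmbedding.subtype_coe hspace).comap_apply, himg,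
    Measure.prod_prod, Real.volume_Ico, sub_zero]
  simp

/-! ### Conclusion. -/

theorem mainTheorem3
    (α : ℝ) (hα : Irrational α) (hbdd : HasBoundedPartialQuotients α)
    (C₁ C₂ : ℝ) (hC₁ : 0 < C₁) (hC₂ : 0 < C₂)
    (hC : ∀ k : ℕ, 1 ≤ k → ∀ ℓ : ℝ, IsPartitionArcLength α k ℓ → C₂ / k ≤ ℓ ∧ ℓ < C₁ / k)
    (f : UnitAddCircle → ℝ) (hfU : f ∈ classU) (hf : ∃ c > 0, ∀ x, c ≤ f x)
    (β : ℕ+ → ℝ) (hβ : ∀ i, β i ∈ Set.Ico (0 : ℝ) 1) (hβinj : Function.Injective β)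
    (hβdisc : ∀ y ∈ Set.Ico (0 : ℝ) 1, ¬ ContinuousAt f (y : UnitAddCircle) → y ∈ Set.range β)
    (η : ℝ → ℝ) (hη : ∀ ε > 0, 0 ≤ η ε)
    (hηlim : Filter.liminf (fun ε : ℝ => ((η ε * ε : ℝ) : EReal)) (𝓝[>] (0 : ℝ)) = 0)
    (hηsum : ∀ ε > 0,
      ∑' i : {i : ℕ+ // η ε < (i : ℝ)}, |circleJump f (β i)| < ε / (C₂ / C₁ + 1)) :
    ¬ IsPartiallyRigid (specialFlow (circleRotation α) f hf)
      (specialMeasure (volume : MeasureTheory.Measure UnitAddCircle) f) := by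
  rintro ⟨t, ht, u, hu, -, hrig⟩
  obtain ⟨c, hc, hcf⟩ := id hf
  have hfm : Measurable f := measurable_of_discontinuities_subset_range hβdisc
  have hsep : ∀ k : ℕ, ∀ i < k, ∀ j < k, i ≠ j →
      C₂ / k ≤ Int.fract ((i : ℝ) * α - j * α) := fun k i hi j hj hij =>
    le_fract_of_le_partitionArcLength hα (fun ℓ hℓ => (hC k (by omega) ℓ hℓ).1) hi hj hij
  obtain ⟨D, hD, hbound⟩ :=
    exists_volume_abs_rotationSum_sub_lt_le hfU hc hcf hβ hβinj hβdisc hα hC₂ hsep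
  have hfreq : ∃ᶠ ε in 𝓝[>] (0 : ℝ), ((η ε * ε : ℝ) : EReal) < ((u / (4 * (D + 1)) : ℝ) : EReal) :=
    frequently_lt_of_liminf_lt (by isBoundedDefault) (by
      rw [hηlim]
      exact_mod_cast (by positivity : 0 < u / (4 * (D + 1))))
  -- With these thresholds `η(ε) ε` and `2 ε` are each at most `u / (4 (D + 1))`, so `D (η(ε) + 2) ε
  -- ≤ u / 2`; `D + 1` avoids division by zero. The bound `ε ≤ c` keeps the strip under the roof.
  have hsmall : 0 < min (min 1 c) (u / (8 * (D + 1))) := by positivity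
  obtain ⟨ε, hηε, hε0, hεs⟩ := (hfreq.and_eventually (Ioo_mem_nhdsGT hsmall)).exists
  have hηε' : η ε * ε < u / (4 * (D + 1)) := by exact_mod_cast hηε
  have hε1 : ε ≤ 1 := hεs.le.trans ((min_le_left _ _).trans (min_le_left _ _))
  have hεc : ε ≤ c := hεs.le.trans ((min_le_left _ _).trans (min_le_right _ _))
  have hεu : ε ≤ u / (8 * (D + 1)) := hεs.le.trans (min_le_right _ _)
  -- The indices `1, …, ⌊η ε⌋`, shifted from a range starting at `0`.
  set H : Finset ℕ+ := (Finset.range ⌊η ε⌋₊).image Nat.succPNat with hH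
  have hHmem : ∀ i : ℕ+, ¬ η ε < (i : ℝ) → i ∈ H := by
    intro i hi
    have h1 : (i : ℕ) ≤ ⌊η ε⌋₊ := Nat.le_floor (by simpa using hi)
    refine Finset.mem_image.mpr ⟨i.natPred, Finset.mem_range.mpr ?_, PNat.succPNat_natPred i⟩
    have := i.natPred_add_one
    omega
  have hHcard : (H.card : ℝ) ≤ η ε := by
    have h1 : H.card ≤ ⌊η ε⌋₊ := Finset.card_image_le.trans (by simp)
    exact (Nat.cast_le.mpr h1).trans (Nat.floor_le (hη ε hε0))
  have htail : ∑' i : {i : ℕ+ // η ε < (i : ℝ)}, |circleJump f (β i)| ≤ ε :=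
    (hηsum ε hε0).le.trans (div_le_self hε0.le (by
      have : 0 ≤ C₂ / C₁ := by positivity
      linarith))
  have hev := hbound ε hε0 hε1 (fun i => η ε < (i : ℝ)) H hHmem htail
  have hDε : D * (H.card + 2) * ε ≤ u / 2 := by
    have h1 : (H.card + 2) * ε ≤ u / (2 * (D + 1)) := by
      calc (H.card + 2) * ε ≤ (η ε + 2) * ε := by gcongr
        _ ≤ u / (4 * (D + 1)) + 2 * (u / (8 * (D + 1))) := by linarith
        _ = u / (2 * (D + 1)) := by field_simp; ring
    calc D * (H.card + 2) * ε = D * ((H.card + 2) * ε) := by ring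
      _ ≤ (D + 1) * (u / (2 * (D + 1))) := by gcongr; linarith
      _ = u / 2 := by field_simp
  have hBm : MeasurableSet {q : specialSpace f | q.1.2 < ε} :=
    measurableSet_lt (measurable_snd.comp measurable_subtype_coe) measurable_const
  have hle := hrig _ hBm
  rw [specialMeasure_bottom hfm fun x => hεc.trans (hcf x)] at hle
  have hlim : liminf (fun n => specialMeasure volume f ({q | q.1.2 < ε} ∩
      specialFlow (circleRotation α) f hf (t n) ⁻¹' {q | q.1.2 < ε})) atTop
      ≤ ENNReal.ofReal (u / 2) * ENNReal.ofReal ε := by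
    refine liminf_le_of_frequently_le' (Eventually.frequently ?_)
    filter_upwards [ht.eventually hev, ht.eventually_gt_atTop ε] with n hn1 hn2
    refine (specialMeasure_bottom_inter_preimage_le hfm hf α hn2).trans ?_
    gcongr
    exact hn1.trans (ENNReal.ofReal_le_ofReal hDε)
  have hfin := hle.trans hlim
  rw [← ENNReal.ofReal_mul hu.le, ← ENNReal.ofReal_mul (by positivity),
    ENNReal.ofReal_le_ofReal_iff (by positivity)] at hfin
  nlinarith [mul_pos hu hε0]
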